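/- **Setting.** A Bayesian RL problem has state and action spaces $\mathcal S,\mathcal A$ with base probability measures $\mu_{\mathcal S},\mu_{\mathcal A}$, an episode length $H$, and a fixed initial state $s_1$. An environment is $\mathcal E=\{(P_h,r_h)\}_{h=1}^H$, where $P_h(\cdot|s,a)$ is a probability density with respect to $\mu_{\mathcal S}$ and $r_h(\cdot|s,a)$ is a probability density on $[0,1]$ with respect to Lebesgue measure. The environment space is $\Theta=\prod_{h}(\Theta_h^P\times\Theta_h^R)$, with countably generated $\sigma$-algebras for which evaluation is measurable, and the prior $\rho$ is a product of priors on all the factors $\Theta_h^P,\Theta_h^R$. For a stationary policy $\pi$ (whose action laws have densities with respect to $\mu_{\mathcal A}$) let $V^{\mathcal E}_{1,\pi}(s_1)$ be the expectation of $\sum_{h=1}^H r_h(s_h,a_h)$ (mean rewards) along the trajectory of $\pi$ in $\mathcal E$ from $s_1$. Let $\mathcal E\mapsto\pi^*_{\mathcal E}$ be a measurable choice, for $\mathcal E\in\Theta$, of an optimal policy within a given policy class $\Pi$. Let $\mathcal D_\ell$ be the history of the first $\ell-1$ episodes of Thompson sampling, and let $\mathbb P_\ell=\mathbb P(\,\cdot\,|\mathcal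 D_\ell)$ be (a regular version of) the posterior of $\mathcal E$. Let $\varepsilon>0$. An *$\varepsilon$-value partition* is a partition of $\Theta$ into measurable cells $\Theta_1,\dots,\Theta_K$ such that $V^{\mathcal E}_{1,\pi^*_{\mathcal E}}(s_1)-V^{\mathcal E'}_{1,\pi^*_{\mathcal E}}(s_1)\le\varepsilon$ whenever $\mathcal E,\mathcal E'$ lie in the same cell. It is *layered* if, under the prior conditioned on any cell of positive prior probability, the layers $(P_h,r_h)$, $h=1,\dots,H$, are independent. Put $\zeta(\mathcal E)=k$ if $\mathcal E\in\Theta_k$. For a choice of environments $\tilde{\mathcal E}_{k,\ell}$ ($k\le K$) that depend measurably on $\mathcal D_\ell$, consider the random environment $\tilde{\mathcal E}^*_\ell=\tilde{\mathcal E}_{\zeta(\mathcal E),\ell}$, a function of $\zeta$ and $\mathcal D_\ell$ only, and the inequality $$\mathbb E_\ell\!\left[V^{\mathcal E}_{1,\pi^*_{\mathcal E}}(s_1)-V^{\mathcal E}_{1,\pi^*_{\mathcal E'}}(s_1)\right]-\mathbb E_\ell\!\left[V^{\tilde{\mathcal E}^*_\ell}_{1,\pi^*_{\mathcal E}}(s_1)-V^{\tilde{\mathcal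 E}^*_\ell}_{1,\pi^*_{\mathcal E'}}(s_1)\right]\le\varepsilon, \qquad (*)$$ where $\mathcal E,\mathcal E'$ are independent with law $\mathbb P_\ell$ and $\pi^\ell_{\mathrm{TS}}=\pi^*_{\mathcal E'}$ is the Thompson sampling policy. **Lemma.** Let an $\varepsilon$-value partition and an episode $\ell\ge1$ be given. 1. There are environments $\tilde{\mathcal E}_{k,\ell}\in\Theta$, depending measurably on $\mathcal D_\ell$, with $\tilde{\mathcal E}_{k,\ell}\in\Theta_k$ whenever $\Theta_k\neq\emptyset$, such that $(*)$ holds for almost every $\mathcal D_\ell$. 2. If the partition is layered, then there are environments $\tilde{\mathcal E}_{k,\ell}$ (not necessarily elements of $\Theta$), depending measurably on $\mathcal D_\ell$, such that $\tilde{\mathcal E}_{k,\ell}$ is the posterior mean over $\Theta_k$ whenever $\mathbb P_\ell(\Theta_k)>0$, i.e. its densities are $\mathbb E_\ell[P_h^{\mathcal E}(\cdot|s,a)\mid\mathcal E\in\Theta_k]$ and $\mathbb E_\ell[r_h^{\mathcal E}(\cdot|s,a)\mid\mathcal E\in\Theta_k]$, and such that $(*)$ holds for almost every $\mathcal D_\ell$.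 -/

import Mathlib

open MeasureTheory ProbabilityTheory
open scoped ENNReal

/-- A transition function `P_h : S × A → Δ_{S, μS}` given by its densities
`dens s a s' = P_h(s' | s, a)` with respect to the base measure `μS`. -/
structure TransitionFn {S : Type*} (A : Type*) [MeasurableSpace S] [MeasurableSpace A]
    (μS : Measure S) where
  dens : S → A → S → ℝ≥0∞
  measurable_dens : Measurable fun z : S × A × S => dens z.1 z.2.1 z.2.2
  lintegral_dens : ∀ s a, ∫⁻ s', dens s a s' ∂μS = 1

/-- A reward function `r_h : S × A → Δ_{[0,1], Lebesgue}` given by its densities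
`dens s a x = r_h(x | s, a)`. -/
structure RewardFn (S A : Type*) [MeasurableSpace S] [MeasurableSpace A] where
  dens : S → A → ℝ → ℝ≥0∞
  measurable_dens : Measurable fun z : S × A × ℝ => dens z.1 z.2.1 z.2.2
  lintegral_dens : ∀ s a, ∫⁻ x in Set.Icc (0 : ℝ) 1, dens s a x = 1

/-- One layer `π_h : S → Δ_{A, μA}` of a stationary policy, given by its densities
`dens s a = π_h(a | s)`. -/
structure PolicyFn (S : Type*) {A : Type*} [MeasurableSpace S] [MeasurableSpace A]
    (μA : Measure A) where
  dens : S → A → ℝ≥0∞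
  measurable_dens : Measurable fun z : S × A => dens z.1 z.2
  lintegral_dens : ∀ s, ∫⁻ a, dens s a ∂μA = 1

section MDP

variable {S A : Type*} [MeasurableSpace S] [MeasurableSpace A]

/-- The conditional law of the reward given the state and the action. -/
noncomputable def RewardFn.law (r : RewardFn S A) (s : S) (a : A) : Measure ℝ :=
  (volume.restrict (Set.Icc (0 : ℝ) 1)).withDensity (r.dens s a)

/-- The mean reward `r(s, a) = ∫₀¹ x r(x | s, a) dx`. -/
noncomputable def RewardFn.mean (r : RewardFn S A) (s : S) (a : A) : ℝ :=
  ∫ x, x ∂(r.law s a)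

/-- The conditional law of the next state given the state and the action. -/
noncomputable def TransitionFn.law {μS : Measure S} (P : TransitionFn A μS) (s : S) (a : A) :
    Measure S :=
  μS.withDensity (P.dens s a)

/-- The conditional law of the action given the state. -/
noncomputable def PolicyFn.law {μA : Measure A} (π : PolicyFn S μA) (s : S) : Measure A :=
  μA.withDensity (π.dens s)

/-- An environment with `m` layers: a transition function and a reward function per layer. -/
abbrev Env (A : Type*) [MeasurableSpace A] (μS : Measure S) (m : ℕ) : Type _ :=
  Fin m → TransitionFn A μS × RewardFn S A

/-- A stationary policy with `m` layers. -/
abbrev Policy (S : Type*) [MeasurableSpace S] (μA : Measure A) (m : ℕ) : Type _ :=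
  Fin m → PolicyFn S μA

/-- A trajectory `(s_1, a_1, r_1, …, s_m, a_m, r_m)`. -/
abbrev Traj (S A : Type*) (m : ℕ) : Type _ := Fin m → S × A × ℝ

/-- The law of the trajectory of the policy `π` in the environment `E`, started from the state `s`:
in every layer the action is drawn from the policy, the reward and the next state from the
environment. -/
noncomputable def trajLaw {μS : Measure S} {μA : Measure A} :
    {m : ℕ} → Env A μS m → Policy S μA m → S → Measure (Traj S A m)
  | 0, _, _, _ => Measure.dirac Fin.elim0
  | m + 1, E, π, s =>
      ((π 0).law s).bind fun a =>
        ((E 0).2.law s a).bind fun x =>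
          ((E 0).1.law s a).bind fun s' =>
            (trajLaw (fun j : Fin m => E j.succ) (fun j : Fin m => π j.succ) s').map
              fun τ => (Fin.cons (s, a, x) τ : Traj S A (m + 1))

/-- The expectation of the sum of the mean rewards `∑ r_h(s_h, a_h)` along the trajectory of `π` in
`E` started from `s`. -/
noncomputable def expectedReturn {μS : Measure S} {μA : Measure A} {m : ℕ} (E : Env A μS m)
    (π : Policy S μA m) (s : S) : ℝ :=
  ∫ τ, ∑ j, (E j).2.mean (τ j).1 (τ j).2.1 ∂(trajLaw E π s)

/-- Forget the first `h` of `H` layers. -/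
def dropLayers {H : ℕ} {α : Type*} (f : Fin H → α) (h : ℕ) : Fin (H - h) → α :=
  fun j => f ⟨h + j, by omega⟩

/-- The value function `V_{h, π}^E(s) = 𝔼_π^E[∑_{h' ≥ h} r_{h'}(s_{h'}, a_{h'}) | s_h = s]`. Layers
are counted from `0`, so that `value E π 0` is the value function of the whole episode, and
`value E π H` is zero. -/
noncomputable def value {μS : Measure S} {μA : Measure A} {H : ℕ} (E : Env A μS H)
    (π : Policy S μA H) (h : ℕ) (s : S) : ℝ :=
  expectedReturn (dropLayers E h) (dropLayers π h) s

end MDP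

/-- A Bayesian reinforcement learning problem with episode length `H`: base probability measures on
the state and the action space, an initial state, for every layer a space of transition functions
and a space of reward functions, each with a (countably generated) `σ`-algebra for which evaluation
is measurable and with a prior, a policy class, and a measurable choice
of an optimal policy in that class for every environment. -/
structure BayesianRL (S A : Type*) [MeasurableSpace S] [MeasurableSpace A] (H : ℕ) where
  μS : Measure S
  isProb_μS : IsProbabilityMeasure μS
  μA : Measure A
  isProb_μA : IsProbabilityMeasure μA
  /-- the initial state -/
  s₁ : S
  /-- the transition functions of layer `h` -/
  ΘP : Fin H → Set (TransitionFn A μS)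
  /-- the reward functions of layer `h` -/
  ΘR : Fin H → Set (RewardFn S A)
  measΘP : ∀ h, MeasurableSpace (ΘP h)
  measΘR : ∀ h, MeasurableSpace (ΘR h)
  countablyGenerated_ΘP : ∀ h, MeasurableSpace.CountablyGenerated (ΘP h)
  countablyGenerated_ΘR : ∀ h, MeasurableSpace.CountablyGenerated (ΘR h)
  measurable_evalP : ∀ h, Measurable fun z : ΘP h × S × A × S =>
    z.1.1.dens z.2.1 z.2.2.1 z.2.2.2
  measurable_evalR : ∀ h, Measurable fun z : ΘR h × S × A × ℝ =>
    z.1.1.dens z.2.1 z.2.2.1 z.2.2.2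
  /-- the priors -/
  ρP : ∀ h, Measure (ΘP h)
  ρR : ∀ h, Measure (ΘR h)
  isProb_ρP : ∀ h, IsProbabilityMeasure (ρP h)
  isProb_ρR : ∀ h, IsProbabilityMeasure (ρR h)
  /-- the policy class `Π` -/
  policies : Set (Policy S μA H)
  /-- the optimal policy `π*_E` of an environment -/
  opt : (∀ h, ΘP h × ΘR h) → Policy S μA H
  measurable_opt : ∀ h, Measurable fun z : (∀ h, ΘP h × ΘR h) × S × A =>
    (opt z.1 h).dens z.2.1 z.2.2
  opt_mem : ∀ θ, opt θ ∈ policies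
  opt_isMax : ∀ θ, ∀ π ∈ policies, ∀ (h : ℕ) (s : S),
    value (fun j => ((θ j).1.1, (θ j).2.1)) π h s
      ≤ value (fun j => ((θ j).1.1, (θ j).2.1)) (opt θ) h s

namespace BayesianRL

variable {S A : Type*} [MeasurableSpace S] [MeasurableSpace A] {H : ℕ}

attribute [instance] isProb_μS isProb_μA measΘP measΘR countablyGenerated_ΘP
  countablyGenerated_ΘR isProb_ρP isProb_ρR

/-- The environment space `Θ = Θ_1 × ⋯ × Θ_H` with `Θ_h = Θ_h^P × Θ_h^R`. -/
abbrev Θ (M : BayesianRL S A H) : Type _ := ∀ h, M.ΘP h × M.ΘR h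

/-- An element of `Θ` as an environment. -/
def env (M : BayesianRL S A H) (θ : M.Θ) : Env A M.μS H := fun h => ((θ h).1.1, (θ h).2.1)

/-- The prior: all transition and reward functions are independent. -/
noncomputable def prior (M : BayesianRL S A H) : Measure M.Θ :=
  Measure.pi fun h => (M.ρP h).prod (M.ρR h)

/-- The value `V_{1, π}^E(s_1)` of a policy in an environment from the initial state. -/
noncomputable def V (M : BayesianRL S A H) (E : Env A M.μS H) (π : Policy S M.μA H) : ℝ :=
  value E π 0 M.s₁

/-- The histories of `n` complete episodes. -/
abbrev Hist (_M : BayesianRL S A H) (n : ℕ) : Type _ := Fin n → Traj S A H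

/-- The joint law of the history of the first `n` episodes and the true environment, when the
environment is drawn from the prior and the agent acts in episode `n + 1`, given the history `d`,
according to the optimal policy of a fresh sample from `Q n d`. -/
noncomputable def jointLaw (M : BayesianRL S A H) (Q : ∀ n, Kernel (M.Hist n) M.Θ) :
    (n : ℕ) → Measure (M.Hist n × M.Θ)
  | 0 => M.prior.map fun θ => (Fin.elim0, θ)
  | n + 1 =>
      (jointLaw M Q n).bind fun z =>
        (Q n z.1).bind fun θ' =>
          (trajLaw (M.env z.2) (M.opt θ') M.s₁).map fun τ => (Fin.snoc z.1 τ, z.2)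

/-- The law of the history of the first `n` episodes. -/
noncomputable def histLaw (M : BayesianRL S A H) (Q : ∀ n, Kernel (M.Hist n) M.Θ) (n : ℕ) :
    Measure (M.Hist n) :=
  (M.jointLaw Q n).fst

/-- `Q n` is the posterior given the history of the first `n` episodes, that is, a regular
conditional distribution of the true environment given that history, where the agent runs Thompson
sampling with these posteriors. -/
def IsPosterior (M : BayesianRL S A H) (Q : ∀ n, Kernel (M.Hist n) M.Θ) : Prop :=
  ∀ n, IsMarkovKernel (Q n) ∧ M.jointLaw Q n = (M.histLaw Q n).compProd (Q n)

/-- The partition of `Θ` into the cells `Θ_k = ζ⁻¹{k}` is an `ε`-value partition. -/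
def IsValuePartition (M : BayesianRL S A H) (ε : ℝ) {K : ℕ} (ζ : M.Θ → Fin K) : Prop :=
  Measurable ζ ∧
    ∀ θ θ' : M.Θ, ζ θ = ζ θ' → M.V (M.env θ) (M.opt θ) - M.V (M.env θ') (M.opt θ) ≤ ε

/-- The partition is layered: conditionally on the cell, the layers of the environment are
independent under the prior. -/
def IsLayered (M : BayesianRL S A H) {K : ℕ} (ζ : M.Θ → Fin K) : Prop :=
  ∀ k, M.prior (ζ ⁻¹' {k}) ≠ 0 →
    iIndepFun (fun (h : Fin H) (θ : M.Θ) => θ h) (M.prior[|ζ ⁻¹' {k}])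

/-- The expected regret of Thompson sampling in the true environment, when `q` is the posterior: the
true environment and the sampled environment are independent with law `q`. -/
noncomputable def tsRegret (M : BayesianRL S A H) (q : Measure M.Θ) : ℝ :=
  ∫ z : M.Θ × M.Θ, (M.V (M.env z.1) (M.opt z.1) - M.V (M.env z.1) (M.opt z.2)) ∂(q.prod q)

/-- The expected regret of Thompson sampling in the surrogate environment, which takes the value
`E k` when the true environment lies in the cell `k`. -/
noncomputable def surrogateRegret (M : BayesianRL S A H) (q : Measure M.Θ) {K : ℕ}
    (ζ : M.Θ → Fin K) (E : Fin K → Env A M.μS H) : ℝ :=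
  ∫ z : M.Θ × M.Θ, (M.V (E (ζ z.1)) (M.opt z.1) - M.V (E (ζ z.1)) (M.opt z.2)) ∂(q.prod q)

/-- `E` is the mean of the environments under the measure `q`: its densities are the means of the
densities. -/
def IsMeanEnv (M : BayesianRL S A H) (q : Measure M.Θ) (E : Env A M.μS H) : Prop :=
  ∀ h s a,
    (∀ s', (E h).1.dens s a s' = ∫⁻ θ, (M.env θ h).1.dens s a s' ∂q) ∧
    (∀ x, (E h).2.dens s a x = ∫⁻ θ, (M.env θ h).2.dens s a x ∂q)

/-- An environment that depends measurably on the history. -/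
def MeasurableEnv (M : BayesianRL S A H) {n : ℕ} (E : M.Hist n → Env A M.μS H) : Prop :=
  ∀ h,
    (Measurable fun z : M.Hist n × S × A × S => (E z.1 h).1.dens z.2.1 z.2.2.1 z.2.2.2) ∧
    (Measurable fun z : M.Hist n × S × A × ℝ => (E z.1 h).2.dens z.2.1 z.2.2.1 z.2.2.2)

end BayesianRL

/-!
Under Thompson sampling the density of a history factorises into the probabilities of its actions,
which do not depend on the true environment, and one likelihood per layer. Hence, up to a constant,
the posterior is the prior tilted by a product of functions of the single layers.

The two regrets are compared term by term. In a value partition, replacing the environment by one of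
its own cell, or by an average over the cell, lowers the value of its optimal policy by at most `ε`.
It remains to choose the surrogates so that the expected value of the policy of an independent
sample does not increase. In the first part this is done by choosing in each cell an environment
whose expected value is at most the average over the cell; such environments have positive posterior
probability, and a measurable choice is made by taking the first admissible term of a sequence which
is generic for the prior. In the second part the tilting keeps the layers independent on every cell,
and the Bellman recursion is affine in each layer, so the return of the mean environment is the mean
of the returns.
-/

section Kernels

variable {X Y Z : Type*} [MeasurableSpace X] [MeasurableSpace Y] [MeasurableSpace Z]

theorem bind_withDensity {q : Measure X} [SFinite q] {μ : Measure Y} [SFinite μ] {f : X → Y → ℝ≥0∞}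
    (hf : Measurable fun z : X × Y => f z.1 z.2) :
    (q.bind fun x => μ.withDensity (f x)) = μ.withDensity fun y => ∫⁻ x, f x y ∂q := by
  ext s hs
  rw [Measure.bind_apply hs (measurable_withDensity hf).aemeasurable, withDensity_apply _ hs]
  simp_rw [withDensity_apply _ hs]
  exact lintegral_lintegral_swap hf.aemeasurable

/-- A measurable family of probability measures. This is the unbundled form of a Markov kernel:
the laws in a problem are given as functions to measures, not as kernels. -/
structure IsMarkovFamily (κ : X → Measure Y) : Prop where
  measurable : Measurable κ
  isProbabilityMeasure : ∀ x, IsProbabilityMeasure (κ x)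

namespace IsMarkovFamily

theorem const (μ : Measure Y) [IsProbabilityMeasure μ] : IsMarkovFamily fun _ : X => μ :=
  ⟨measurable_const, fun _ => inferInstance⟩

theorem dirac {f : X → Y} (hf : Measurable f) : IsMarkovFamily fun x => Measure.dirac (f x) :=
  ⟨Measure.measurable_dirac.comp hf, fun _ => inferInstance⟩

theorem comp {κ : Y → Measure Z} (hκ : IsMarkovFamily κ) {g : X → Y} (hg : Measurable g) :
    IsMarkovFamily fun x => κ (g x) :=
  ⟨hκ.measurable.comp hg, fun x => hκ.isProbabilityMeasure (g x)⟩

theorem measurable_lintegral {κ : X → Measure Y} (hκ : IsMarkovFamily κ) {f : X → Y → ℝ≥0∞}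
    (hf : Measurable fun z : X × Y => f z.1 z.2) : Measurable fun x => ∫⁻ y, f x y ∂(κ x) :=
  have : IsMarkovKernel (⟨κ, hκ.measurable⟩ : Kernel X Y) := ⟨hκ.isProbabilityMeasure⟩
  Measurable.lintegral_kernel_prod_right (κ := ⟨κ, hκ.measurable⟩) hf

theorem bind {κ : X → Measure Y} (hκ : IsMarkovFamily κ) {η : X → Y → Measure Z}
    (hη : IsMarkovFamily fun z : X × Y => η z.1 z.2) :
    IsMarkovFamily fun x => (κ x).bind (η x) where
  measurable := by
    refine Measure.measurable_of_measurable_coe _ fun s hs => ?_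
    have bind_apply (x : X) : (κ x).bind (η x) s = ∫⁻ y, η x y s ∂(κ x) :=
      Measure.bind_apply hs (hη.measurable.comp measurable_prodMk_left).aemeasurable
    simp_rw [bind_apply]
    exact hκ.measurable_lintegral ((Measure.measurable_coe hs).comp hη.measurable)
  isProbabilityMeasure x := by
    have := hκ.isProbabilityMeasure x
    have hη' : IsMarkovFamily (η x) := hη.comp measurable_prodMk_left
    have := hη'.isProbabilityMeasure
    exact ⟨by simp [Measure.bind_apply .univ hη'.measurable.aemeasurable]⟩

theorem map {κ : X → Measure Y} (hκ : IsMarkovFamily κ) {f : X → Y → Z}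
    (hf : Measurable fun z : X × Y => f z.1 z.2) : IsMarkovFamily fun x => (κ x).map (f x) := by
  have map_eq_bind (x : X) : (κ x).map (f x) = (κ x).bind fun y => Measure.dirac (f x y) :=
    (Measure.bind_dirac_eq_map _ (hf.comp measurable_prodMk_left)).symm
  simp_rw [map_eq_bind]
  exact hκ.bind (dirac hf)

theorem withDensity {μ : Measure Y} [SFinite μ] {f : X → Y → ℝ≥0∞}
    (hf : Measurable fun z : X × Y => f z.1 z.2) (hf' : ∀ x, ∫⁻ y, f x y ∂μ = 1) :
    IsMarkovFamily fun x => μ.withDensity (f x) where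
  measurable := measurable_withDensity hf
  isProbabilityMeasure x := ⟨by rw [withDensity_apply _ .univ, setLIntegral_univ, hf' x]⟩

end IsMarkovFamily

theorem measurable_finCons {n : ℕ} :
    Measurable fun z : Y × (Fin n → Y) => (Fin.cons z.1 z.2 : Fin (n + 1) → Y) :=
  measurable_pi_iff.2 <| Fin.cases (by simpa using measurable_fst) fun j => by
    simpa using by fun_prop

theorem measurable_finSnoc {n : ℕ} :
    Measurable fun z : (Fin n → Y) × Y => (Fin.snoc z.1 z.2 : Fin (n + 1) → Y) :=
  measurable_pi_iff.2 <| Fin.lastCases (by simpa using measurable_snd) fun j => by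
    simpa using by fun_prop

end Kernels

section Families

variable {S A : Type*} [MeasurableSpace S] [MeasurableSpace A] {μS : Measure S} {μA : Measure A}
  {T : Type*} [MeasurableSpace T] {m : ℕ}

/-- A layer of an environment that depends measurably on a parameter. -/
def MeasurableLayerFamily (e : T → TransitionFn A μS × RewardFn S A) : Prop :=
  (Measurable fun z : T × S × A × S => (e z.1).1.dens z.2.1 z.2.2.1 z.2.2.2) ∧
    (Measurable fun z : T × S × A × ℝ => (e z.1).2.dens z.2.1 z.2.2.1 z.2.2.2)

/-- An environment that depends measurably on a parameter. For a history as the parameter this is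
`BayesianRL.MeasurableEnv`. -/
def MeasurableEnvFamily (E : T → Env A μS m) : Prop :=
  ∀ h, MeasurableLayerFamily fun t => E t h

/-- A policy that depends measurably on a parameter. -/
def MeasurablePolicyFamily (π : T → Policy S μA m) : Prop :=
  ∀ h, Measurable fun z : T × S × A => (π z.1 h).dens z.2.1 z.2.2

theorem measurableEnvFamily_const (E : Env A μS m) : MeasurableEnvFamily fun _ : T => E := fun h =>
  ⟨(E h).1.measurable_dens.comp measurable_snd, (E h).2.measurable_dens.comp measurable_snd⟩

theorem measurablePolicyFamily_const (π : Policy S μA m) :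
    MeasurablePolicyFamily fun _ : T => π := fun h =>
  (π h).measurable_dens.comp measurable_snd

section Comp

variable {U : Type*} [MeasurableSpace U] {g : U → T}

theorem MeasurableLayerFamily.comp {e : T → TransitionFn A μS × RewardFn S A}
    (he : MeasurableLayerFamily e) (hg : Measurable g) : MeasurableLayerFamily fun u => e (g u) :=
  ⟨he.1.comp (f := fun z : U × S × A × S => (g z.1, z.2)) (by fun_prop),
    he.2.comp (f := fun z : U × S × A × ℝ => (g z.1, z.2)) (by fun_prop)⟩

theorem MeasurableEnvFamily.comp {E : T → Env A μS m} (hE : MeasurableEnvFamily E)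
    (hg : Measurable g) : MeasurableEnvFamily fun u => E (g u) :=
  fun h => (hE h).comp hg

theorem MeasurablePolicyFamily.comp {π : T → Policy S μA m} (hπ : MeasurablePolicyFamily π)
    (hg : Measurable g) : MeasurablePolicyFamily fun u => π (g u) :=
  fun h => (hπ h).comp (f := fun z : U × S × A => (g z.1, z.2)) (by fun_prop)

end Comp

theorem MeasurableEnvFamily.tail {E : T → Env A μS (m + 1)} (hE : MeasurableEnvFamily E) :
    MeasurableEnvFamily fun t => fun j : Fin m => E t j.succ := fun h => hE h.succ

theorem MeasurablePolicyFamily.tail {π : T → Policy S μA (m + 1)}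
    (hπ : MeasurablePolicyFamily π) :
    MeasurablePolicyFamily fun t => fun j : Fin m => π t j.succ := fun h => hπ h.succ

theorem PolicyFn.measurable_dens_right (π : PolicyFn S μA) (s : S) : Measurable (π.dens s) :=
  π.measurable_dens.comp measurable_prodMk_left

theorem TransitionFn.measurable_dens_right (P : TransitionFn A μS) (s : S) (a : A) :
    Measurable (P.dens s a) :=
  P.measurable_dens.comp (f := fun s' => (s, a, s')) (by fun_prop)

theorem RewardFn.measurable_dens_right (r : RewardFn S A) (s : S) (a : A) :
    Measurable (r.dens s a) :=
  r.measurable_dens.comp (f := fun x => (s, a, x)) (by fun_prop)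

theorem MeasurablePolicyFamily.isMarkovFamily_law [SFinite μA] {π : T → Policy S μA m}
    (hπ : MeasurablePolicyFamily π) (h : Fin m) :
    IsMarkovFamily fun z : T × S => (π z.1 h).law z.2 :=
  .withDensity ((hπ h).comp (f := fun z : (T × S) × A => (z.1.1, z.1.2, z.2)) (by fun_prop))
    fun z => (π z.1 h).lintegral_dens z.2

theorem MeasurableLayerFamily.isMarkovFamily_transition_law [SFinite μS]
    {e : T → TransitionFn A μS × RewardFn S A} (he : MeasurableLayerFamily e) :
    IsMarkovFamily fun z : T × S × A => (e z.1).1.law z.2.1 z.2.2 :=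
  .withDensity (he.1.comp (f := fun z : (T × S × A) × S => (z.1.1, z.1.2.1, z.1.2.2, z.2))
    (by fun_prop)) fun z => (e z.1).1.lintegral_dens z.2.1 z.2.2

theorem MeasurableLayerFamily.isMarkovFamily_reward_law
    {e : T → TransitionFn A μS × RewardFn S A} (he : MeasurableLayerFamily e) :
    IsMarkovFamily fun z : T × S × A => (e z.1).2.law z.2.1 z.2.2 :=
  .withDensity (he.2.comp (f := fun z : (T × S × A) × ℝ => (z.1.1, z.1.2.1, z.1.2.2, z.2))
    (by fun_prop)) fun z => (e z.1).2.lintegral_dens z.2.1 z.2.2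

end Families

section TrajLaw

variable {S A : Type*} [MeasurableSpace S] [MeasurableSpace A] {μS : Measure S} {μA : Measure A}
  [SFinite μS] [SFinite μA] {T : Type*} [MeasurableSpace T] {m : ℕ}

theorem isMarkovFamily_trajLaw {E : T → Env A μS m} {π : T → Policy S μA m}
    (hE : MeasurableEnvFamily E) (hπ : MeasurablePolicyFamily π) :
    IsMarkovFamily fun z : T × S => trajLaw (E z.1) (π z.1) z.2 := by
  induction m with
  | zero => exact .const (Measure.dirac Fin.elim0)
  | succ m ih =>
    refine (hπ.isMarkovFamily_law 0).bind ?_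
    refine ((hE 0).isMarkovFamily_reward_law.comp
      (g := fun z : (T × S) × A => (z.1.1, z.1.2, z.2)) (by fun_prop)).bind ?_
    refine ((hE 0).isMarkovFamily_transition_law.comp
      (g := fun z : ((T × S) × A) × ℝ => (z.1.1.1, z.1.1.2, z.1.2)) (by fun_prop)).bind ?_
    refine ((ih hE.tail hπ.tail).comp
      (g := fun z : (((T × S) × A) × ℝ) × S => (z.1.1.1.1, z.2)) (by fun_prop)).map ?_
    exact measurable_finCons.comp (f := fun z : ((((T × S) × A) × ℝ) × S) × Traj S A m =>
      ((z.1.1.1.1.2, z.1.1.1.2, z.1.1.2), z.2)) (by fun_prop)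

instance isProbabilityMeasure_trajLaw (E : Env A μS m) (π : Policy S μA m) (s : S) :
    IsProbabilityMeasure (trajLaw E π s) :=
  (isMarkovFamily_trajLaw (T := Unit) (measurableEnvFamily_const E)
    (measurablePolicyFamily_const π)).isProbabilityMeasure ((), s)

theorem lintegral_trajLaw_succ (E : Env A μS (m + 1)) (π : Policy S μA (m + 1)) (s : S)
    {f : Traj S A (m + 1) → ℝ≥0∞} (hf : Measurable f) :
    ∫⁻ τ, f τ ∂(trajLaw E π s) =
      ∫⁻ a, ∫⁻ x, ∫⁻ s', ∫⁻ τ, f (Fin.cons (s, a, x) τ)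
        ∂(trajLaw (fun j : Fin m => E j.succ) (fun j : Fin m => π j.succ) s')
        ∂((E 0).1.law s a) ∂((E 0).2.law s a) ∂((π 0).law s) := by
  have hE (T : Type _) [MeasurableSpace T] : MeasurableEnvFamily fun _ : T => E :=
    measurableEnvFamily_const E
  let next (a : A) (x : ℝ) (s' : S) : Measure (Traj S A (m + 1)) :=
    (trajLaw (fun j : Fin m => E j.succ) (fun j : Fin m => π j.succ) s').map
      fun τ => Fin.cons (s, a, x) τ
  have next_family : IsMarkovFamily fun z : (A × ℝ) × S => next z.1.1 z.1.2 z.2 :=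
    (isMarkovFamily_trajLaw (hE (A × ℝ)).tail (measurablePolicyFamily_const π).tail).map
      (measurable_finCons.comp (f := fun z : ((A × ℝ) × S) × Traj S A m =>
        ((s, z.1.1.1, z.1.1.2), z.2)) (by fun_prop))
  have transition_family : IsMarkovFamily fun z : A × ℝ =>
      ((E 0).1.law s z.1).bind (next z.1 z.2) :=
    ((hE A 0).isMarkovFamily_transition_law.comp
      (g := fun z : A × ℝ => (z.1, s, z.1)) (by fun_prop)).bind next_family
  have reward_family : IsMarkovFamily fun a : A =>
      ((E 0).2.law s a).bind fun x => ((E 0).1.law s a).bind (next a x) :=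
    ((hE A 0).isMarkovFamily_reward_law.comp (g := fun a => (a, s, a)) (by fun_prop)).bind
      transition_family
  rw [trajLaw, Measure.lintegral_bind reward_family.measurable.aemeasurable hf.aemeasurable]
  refine lintegral_congr fun a => ?_
  rw [Measure.lintegral_bind (transition_family.comp
    (measurable_prodMk_left (x := a))).measurable.aemeasurable hf.aemeasurable]
  refine lintegral_congr fun x => ?_
  rw [Measure.lintegral_bind (next_family.comp
    (measurable_prodMk_left (x := (a, x)))).measurable.aemeasurable hf.aemeasurable]
  exact lintegral_congr fun s' => lintegral_map hf (measurable_finCons.comp measurable_prodMk_left)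

end TrajLaw

section Return

variable {S A : Type*} [MeasurableSpace S] [MeasurableSpace A] {μS : Measure S} {μA : Measure A}
  {T : Type*} [MeasurableSpace T] {m : ℕ}

theorem PolicyFn.lintegral_law (π : PolicyFn S μA) (s : S) (g : A → ℝ≥0∞) :
    ∫⁻ a, g a ∂(π.law s) = ∫⁻ a, π.dens s a * g a ∂μA :=
  lintegral_withDensity_eq_lintegral_mul_non_measurable _ (π.measurable_dens_right s)
    (ae_lt_top (π.measurable_dens_right s) (by simp [π.lintegral_dens])) g

theorem TransitionFn.lintegral_law (P : TransitionFn A μS) (s : S) (a : A) (g : S → ℝ≥0∞) :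
    ∫⁻ s', g s' ∂(P.law s a) = ∫⁻ s', P.dens s a s' * g s' ∂μS :=
  lintegral_withDensity_eq_lintegral_mul_non_measurable _ (P.measurable_dens_right s a)
    (ae_lt_top (P.measurable_dens_right s a) (by simp [P.lintegral_dens])) g

theorem RewardFn.lintegral_law (r : RewardFn S A) (s : S) (a : A) (g : ℝ → ℝ≥0∞) :
    ∫⁻ x, g x ∂(r.law s a) = ∫⁻ x in Set.Icc (0 : ℝ) 1, r.dens s a x * g x :=
  lintegral_withDensity_eq_lintegral_mul_non_measurable _ (r.measurable_dens_right s a)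
    (ae_lt_top (r.measurable_dens_right s a) (by simp [r.lintegral_dens])) g

instance PolicyFn.isProbabilityMeasure_law (π : PolicyFn S μA) (s : S) :
    IsProbabilityMeasure (π.law s) :=
  ⟨by rw [← lintegral_one, π.lintegral_law]; simp [π.lintegral_dens]⟩

instance TransitionFn.isProbabilityMeasure_law (P : TransitionFn A μS) (s : S) (a : A) :
    IsProbabilityMeasure (P.law s a) :=
  ⟨by rw [← lintegral_one, P.lintegral_law]; simp [P.lintegral_dens]⟩

instance RewardFn.isProbabilityMeasure_law (r : RewardFn S A) (s : S) (a : A) :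
    IsProbabilityMeasure (r.law s a) :=
  ⟨by rw [← lintegral_one, r.lintegral_law]; simp [r.lintegral_dens]⟩

theorem RewardFn.ae_law_mem_Icc (r : RewardFn S A) (s : S) (a : A) :
    ∀ᵐ x ∂(r.law s a), x ∈ Set.Icc (0 : ℝ) 1 :=
  (withDensity_absolutelyContinuous _ _).ae_le (ae_restrict_mem measurableSet_Icc)

/-- The mean reward as an extended nonnegative number. -/
noncomputable def RewardFn.lmean (r : RewardFn S A) (s : S) (a : A) : ℝ≥0∞ :=
  ∫⁻ x, ENNReal.ofReal x ∂(r.law s a)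

theorem RewardFn.lmean_le_one (r : RewardFn S A) (s : S) (a : A) : r.lmean s a ≤ 1 := by
  refine (lintegral_mono_ae ?_).trans_eq (lintegral_one.trans measure_univ)
  filter_upwards [r.ae_law_mem_Icc s a] with x hx
  simpa using hx.2

theorem RewardFn.lmean_lt_top (r : RewardFn S A) (s : S) (a : A) : r.lmean s a < ∞ :=
  (r.lmean_le_one s a).trans_lt ENNReal.one_lt_top

theorem RewardFn.mean_eq (r : RewardFn S A) (s : S) (a : A) :
    r.mean s a = (r.lmean s a).toReal :=
  integral_eq_lintegral_of_nonneg_ae ((r.ae_law_mem_Icc s a).mono fun _ hx => hx.1) (by fun_prop)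

theorem MeasurableLayerFamily.measurable_lmean {e : T → TransitionFn A μS × RewardFn S A}
    (he : MeasurableLayerFamily e) :
    Measurable fun z : T × S × A => (e z.1).2.lmean z.2.1 z.2.2 :=
  he.isMarkovFamily_reward_law.measurable_lintegral (f := fun _ x => ENNReal.ofReal x)
    (by fun_prop)

/-- The Bellman operator of a layer: the mean reward plus the expected value of `f` at the next
state. -/
noncomputable def bellman (e : TransitionFn A μS × RewardFn S A) (f : S → ℝ≥0∞) (s : S) (a : A) :
    ℝ≥0∞ :=
  e.2.lmean s a + ∫⁻ s', f s' ∂(e.1.law s a)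

theorem MeasurableLayerFamily.measurable_bellman [SFinite μS]
    {e : T → TransitionFn A μS × RewardFn S A} (he : MeasurableLayerFamily e)
    {f : T → S → ℝ≥0∞} (hf : Measurable fun z : T × S => f z.1 z.2) :
    Measurable fun z : T × S × A => bellman (e z.1) (f z.1) z.2.1 z.2.2 :=
  he.measurable_lmean.add <| he.isMarkovFamily_transition_law.measurable_lintegral
    (f := fun z : T × S × A => f z.1) <|
      hf.comp (f := fun z : (T × S × A) × S => (z.1.1, z.2)) (by fun_prop)

/-- The expected return by backward recursion, as an extended nonnegative number. -/
noncomputable def lreturn : {m : ℕ} → Env A μS m → Policy S μA m → S → ℝ≥0∞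
  | 0, _, _, _ => 0
  | _ + 1, E, π, s =>
      ∫⁻ a, bellman (E 0) (lreturn (fun j => E j.succ) fun j => π j.succ) s a ∂((π 0).law s)

theorem measurable_sum_lmean (E : Env A μS m) :
    Measurable fun τ : Traj S A m => ∑ j, (E j).2.lmean (τ j).1 (τ j).2.1 :=
  Finset.measurable_sum _ fun j _ =>
    (measurableEnvFamily_const (T := Unit) E j).measurable_lmean.comp
      (f := fun τ : Traj S A m => ((), (τ j).1, (τ j).2.1)) (by fun_prop)

variable [SFinite μS] [SFinite μA]

theorem measurable_lreturn {E : T → Env A μS m} {π : T → Policy S μA m}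
    (hE : MeasurableEnvFamily E) (hπ : MeasurablePolicyFamily π) :
    Measurable fun z : T × S => lreturn (E z.1) (π z.1) z.2 := by
  induction m with
  | zero => exact measurable_const
  | succ m ih =>
    have backup : Measurable fun z : T × S × A => bellman (E z.1 0)
        (lreturn (fun j => E z.1 j.succ) fun j => π z.1 j.succ) z.2.1 z.2.2 :=
      (hE 0).measurable_bellman (f := fun t => lreturn (fun j => E t j.succ) fun j => π t j.succ)
        (ih hE.tail hπ.tail)
    exact (hπ.isMarkovFamily_law 0).measurable_lintegral
      (backup.comp (f := fun z : (T × S) × A => (z.1.1, z.1.2, z.2)) (by fun_prop))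

theorem measurable_lreturn_right (E : Env A μS m) (π : Policy S μA m) :
    Measurable (lreturn E π) :=
  (measurable_lreturn (measurableEnvFamily_const (T := Unit) E)
    (measurablePolicyFamily_const π)).comp (measurable_prodMk_left (x := ()))

theorem lintegral_sum_lmean (E : Env A μS m) (π : Policy S μA m) (s : S) :
    ∫⁻ τ, ∑ j, (E j).2.lmean (τ j).1 (τ j).2.1 ∂(trajLaw E π s) = lreturn E π s := by
  induction m generalizing s with
  | zero => simp [lreturn]
  | succ m ih =>
    rw [lintegral_trajLaw_succ E π s (measurable_sum_lmean E), lreturn]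
    refine lintegral_congr fun a => ?_
    simp_rw [Fin.sum_univ_succ, Fin.cons_zero, Fin.cons_succ, lintegral_add_left measurable_const,
      ih, lintegral_const, measure_univ, mul_one, lintegral_add_left measurable_const,
      lintegral_const, measure_univ, mul_one, bellman]

theorem lreturn_le (E : Env A μS m) (π : Policy S μA m) (s : S) : lreturn E π s ≤ m := by
  rw [← lintegral_sum_lmean]
  calc ∫⁻ τ, ∑ j, (E j).2.lmean (τ j).1 (τ j).2.1 ∂(trajLaw E π s)
      ≤ ∫⁻ _, (m : ℝ≥0∞) ∂(trajLaw E π s) := lintegral_mono fun τ => by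
        simpa using Finset.sum_le_sum (s := Finset.univ) fun j _ =>
          (E j).2.lmean_le_one (τ j).1 (τ j).2.1
    _ = m := by simp

theorem expectedReturn_eq (E : Env A μS m) (π : Policy S μA m) (s : S) :
    expectedReturn E π s = (lreturn E π s).toReal := by
  have sum_mean (τ : Traj S A m) : ∑ j, (E j).2.mean (τ j).1 (τ j).2.1 =
      (∑ j, (E j).2.lmean (τ j).1 (τ j).2.1).toReal := by
    rw [ENNReal.toReal_sum fun j _ => ((E j).2.lmean_lt_top _ _).ne]
    simp only [RewardFn.mean_eq]
  simp_rw [expectedReturn, ← lintegral_sum_lmean, sum_mean]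
  exact integral_toReal (measurable_sum_lmean E).aemeasurable <| ae_of_all _ fun τ =>
    ENNReal.sum_lt_top.2 fun j _ => (E j).2.lmean_lt_top _ _

end Return

namespace BayesianRL

variable {S A : Type*} [MeasurableSpace S] [MeasurableSpace A] {H : ℕ} (M : BayesianRL S A H)

theorem V_eq (E : Env A M.μS H) (π : Policy S M.μA H) : M.V E π = (lreturn E π M.s₁).toReal := by
  rw [← expectedReturn_eq]
  have dropLayers_zero {α : Type _} (f : Fin H → α) : (dropLayers f 0 : Fin H → α) = f :=
    funext fun j => congrArg f (Fin.ext (Nat.zero_add _))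
  exact congrArg₂ (fun (E : Env A M.μS H) (π : Policy S M.μA H) => expectedReturn E π M.s₁)
    (dropLayers_zero E) (dropLayers_zero π)

/-- A pair of a transition and a reward function from the spaces of a layer, as a layer of an
environment. -/
def layer (h : Fin H) (e : M.ΘP h × M.ΘR h) : TransitionFn A M.μS × RewardFn S A := (e.1.1, e.2.1)

theorem measurableLayerFamily_layer (h : Fin H) : MeasurableLayerFamily (M.layer h) :=
  ⟨(M.measurable_evalP h).comp (f := fun z : (M.ΘP h × M.ΘR h) × S × A × S => (z.1.1, z.2))
      (by fun_prop),
    (M.measurable_evalR h).comp (f := fun z : (M.ΘP h × M.ΘR h) × S × A × ℝ => (z.1.2, z.2))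
      (by fun_prop)⟩

theorem measurableEnvFamily_env : MeasurableEnvFamily M.env := fun h =>
  (M.measurableLayerFamily_layer h).comp (measurable_pi_apply h)

theorem measurablePolicyFamily_opt : MeasurablePolicyFamily M.opt :=
  M.measurable_opt

end BayesianRL

section MeanLayer

variable {S A : Type*} [MeasurableSpace S] [MeasurableSpace A] {μS : Measure S} [SFinite μS]
  {X Y : Type*} [MeasurableSpace X] [MeasurableSpace Y]

/-- The mean of a random layer: its densities are the means of the densities. -/
noncomputable def meanLayer {e : X → TransitionFn A μS × RewardFn S A}
    (he : MeasurableLayerFamily e) (q : Measure X) [IsProbabilityMeasure q] :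
    TransitionFn A μS × RewardFn S A :=
  (⟨fun s a s' => ∫⁻ x, (e x).1.dens s a s' ∂q,
      (he.1.comp (f := fun z : (S × A × S) × X => (z.2, z.1)) (by fun_prop)).lintegral_prod_right',
      fun s a => by
        rw [lintegral_lintegral_swap (f := fun y x => (e x).1.dens s a y) (he.1.comp
          (f := fun z : S × X => (z.2, s, a, z.1)) (by fun_prop)).aemeasurable]
        simp [(e _).1.lintegral_dens]⟩,
    ⟨fun s a r => ∫⁻ x, (e x).2.dens s a r ∂q,
      (he.2.comp (f := fun z : (S × A × ℝ) × X => (z.2, z.1)) (by fun_prop)).lintegral_prod_right',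
      fun s a => by
        rw [lintegral_lintegral_swap (f := fun y x => (e x).2.dens s a y) (he.2.comp
          (f := fun z : ℝ × X => (z.2, s, a, z.1)) (by fun_prop)).aemeasurable]
        simp [(e _).2.lintegral_dens]⟩)

variable {e : X → TransitionFn A μS × RewardFn S A} (he : MeasurableLayerFamily e)

theorem meanLayer_map {g : Y → X} (hg : Measurable g) (q : Measure Y) [IsProbabilityMeasure q]
    [IsProbabilityMeasure (q.map g)] : meanLayer he (q.map g) = meanLayer (he.comp hg) q := by
  have transition (s : S) (a : A) (s' : S) :
      ∫⁻ x, (e x).1.dens s a s' ∂(q.map g) = ∫⁻ y, (e (g y)).1.dens s a s' ∂q :=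
    lintegral_map (he.1.comp (f := fun x => (x, s, a, s')) (by fun_prop)) hg
  have reward (s : S) (a : A) (r : ℝ) :
      ∫⁻ x, (e x).2.dens s a r ∂(q.map g) = ∫⁻ y, (e (g y)).2.dens s a r ∂q :=
    lintegral_map (he.2.comp (f := fun x => (x, s, a, r)) (by fun_prop)) hg
  simp only [meanLayer, transition, reward]

theorem MeasurableLayerFamily.meanLayer (κ : Kernel Y X) [IsMarkovKernel κ] :
    MeasurableLayerFamily fun y => meanLayer he (κ y) :=
  have hκ : IsMarkovFamily κ := ⟨κ.measurable, fun _ => inferInstance⟩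
  ⟨(hκ.comp measurable_fst).measurable_lintegral
      (he.1.comp (f := fun z : (Y × S × A × S) × X => (z.2, z.1.2)) (by fun_prop)),
    (hκ.comp measurable_fst).measurable_lintegral
      (he.2.comp (f := fun z : (Y × S × A × ℝ) × X => (z.2, z.1.2)) (by fun_prop))⟩

variable (q : Measure X) [IsProbabilityMeasure q] (s : S) (a : A)

theorem meanLayer_transition_law :
    (meanLayer he q).1.law s a = q.bind fun x => (e x).1.law s a :=
  (bind_withDensity
    (he.1.comp (f := fun z : X × S => (z.1, s, a, z.2)) (by fun_prop))).symm

theorem meanLayer_reward_law :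
    (meanLayer he q).2.law s a = q.bind fun x => (e x).2.law s a :=
  (bind_withDensity
    (he.2.comp (f := fun z : X × ℝ => (z.1, s, a, z.2)) (by fun_prop))).symm

theorem lintegral_bellman_layer {f : S → ℝ≥0∞} (hf : Measurable f) :
    ∫⁻ x, bellman (e x) f s a ∂q = bellman (meanLayer he q) f s a := by
  have at_sa : Measurable fun x : X => (x, s, a) := by fun_prop
  have lmean_meanLayer : (meanLayer he q).2.lmean s a = ∫⁻ x, (e x).2.lmean s a ∂q := by
    rw [RewardFn.lmean, meanLayer_reward_law]
    exact Measure.lintegral_bind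
      (he.isMarkovFamily_reward_law.comp at_sa).measurable.aemeasurable (by fun_prop)
  simp only [bellman]
  rw [lmean_meanLayer, meanLayer_transition_law, Measure.lintegral_bind
    (he.isMarkovFamily_transition_law.comp at_sa).measurable.aemeasurable hf.aemeasurable]
  exact lintegral_add_left (he.measurable_lmean.comp at_sa) _

omit [SFinite μS] in
theorem lintegral_bellman_continuation (e : TransitionFn A μS × RewardFn S A) {f : X → S → ℝ≥0∞}
    (hf : Measurable fun z : X × S => f z.1 z.2) :
    ∫⁻ x, bellman e (f x) s a ∂q = bellman e (fun s' => ∫⁻ x, f x s' ∂q) s a := by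
  simp only [bellman]
  rw [lintegral_add_left measurable_const, lintegral_lintegral_swap hf.aemeasurable]
  simp

end MeanLayer

section MeanReturn

variable {S A : Type*} [MeasurableSpace S] [MeasurableSpace A] {μS : Measure S} {μA : Measure A}
  [SFinite μS] [SFinite μA] {m : ℕ}

/-- The mean of a random environment: its densities are the means of the densities. -/
noncomputable def meanEnv {T : Type*} [MeasurableSpace T] {E : T → Env A μS m}
    (hE : MeasurableEnvFamily E) (q : Measure T) [IsProbabilityMeasure q] : Env A μS m :=
  fun h => meanLayer (hE h) q

variable {X : Fin m → Type*} [∀ h, MeasurableSpace (X h)]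
  {e : ∀ h, X h → TransitionFn A μS × RewardFn S A} (he : ∀ h, MeasurableLayerFamily (e h))

theorem lintegral_lreturn_pi (κ : ∀ h, Measure (X h)) [∀ h, IsProbabilityMeasure (κ h)]
    (π : Policy S μA m) (s : S) :
    ∫⁻ x, lreturn (fun h => e h (x h)) π s ∂(Measure.pi κ) =
      lreturn (fun h => meanLayer (he h) (κ h)) π s := by
  induction m generalizing s with
  | zero => simp [lreturn]
  | succ m ih =>
    let tail (y : ∀ j : Fin m, X j.succ) : S → ℝ≥0∞ :=
      lreturn (fun j => e j.succ (y j)) fun j => π j.succ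
    have measurable_tail : Measurable fun z : (∀ j : Fin m, X j.succ) × S => tail z.1 z.2 :=
      measurable_lreturn (fun j => (he j.succ).comp (measurable_pi_apply j))
        (measurablePolicyFamily_const fun j => π j.succ)
    have measurable_backup : Measurable fun z : (X 0 × ∀ j : Fin m, X j.succ) × A =>
        bellman (e 0 z.1.1) (tail z.1.2) s z.2 :=
      (((he 0).comp measurable_fst).measurable_bellman
        (f := fun z : X 0 × ∀ j : Fin m, X j.succ => tail z.2)
        (measurable_tail.comp (f := fun z : (X 0 × ∀ j : Fin m, X j.succ) × S => (z.1.2, z.2))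
          (by fun_prop))).comp (f := fun z : (X 0 × ∀ j : Fin m, X j.succ) × A => (z.1, s, z.2))
        (by fun_prop)
    calc ∫⁻ x, lreturn (fun h => e h (x h)) π s ∂(Measure.pi κ)
        = ∫⁻ z, ∫⁻ a, bellman (e 0 z.1) (tail z.2) s a ∂((π 0).law s)
            ∂((κ 0).prod (Measure.pi fun j : Fin m => κ j.succ)) :=
          (measurePreserving_piFinSuccAbove κ 0).lintegral_comp
            (f := fun z => ∫⁻ a, bellman (e 0 z.1) (tail z.2) s a ∂((π 0).law s))
            measurable_backup.lintegral_prod_right'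
      _ = ∫⁻ a, ∫⁻ x, ∫⁻ y, bellman (e 0 x) (tail y) s a
            ∂(Measure.pi fun j : Fin m => κ j.succ) ∂(κ 0) ∂((π 0).law s) := by
          rw [lintegral_lintegral_swap measurable_backup.aemeasurable]
          exact lintegral_congr fun a => lintegral_prod _
            (measurable_backup.comp measurable_prodMk_right).aemeasurable
      _ = lreturn (fun h => meanLayer (he h) (κ h)) π s := by
          simp_rw [lintegral_bellman_continuation _ s _ _ measurable_tail]
          simp_rw [tail, ih fun j => he j.succ]
          simp_rw [lintegral_bellman_layer (he 0) _ s _ (measurable_lreturn_right _ _)]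
          rfl

theorem lintegral_lreturn_of_iIndepFun {Ω : Type*} [MeasurableSpace Ω] {q : Measure Ω}
    [IsProbabilityMeasure q] {Y : ∀ h, Ω → X h} (hY : ∀ h, Measurable (Y h))
    (hind : iIndepFun Y q) (π : Policy S μA m) (s : S) :
    ∫⁻ ω, lreturn (fun h => e h (Y h ω)) π s ∂q =
      lreturn (meanEnv (fun h => (he h).comp (hY h)) q) π s := by
  have (h : Fin m) : IsProbabilityMeasure (q.map (Y h)) :=
    Measure.isProbabilityMeasure_map (hY h).aemeasurable
  have measurable_return : Measurable fun x : ∀ h, X h => lreturn (fun h => e h (x h)) π s :=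
    (measurable_lreturn (fun h => (he h).comp (measurable_pi_apply h))
      (measurablePolicyFamily_const π)).comp measurable_prodMk_right
  calc ∫⁻ ω, lreturn (fun h => e h (Y h ω)) π s ∂q
      = ∫⁻ x, lreturn (fun h => e h (x h)) π s ∂(q.map fun ω h => Y h ω) :=
        (lintegral_map measurable_return (measurable_pi_lambda _ hY)).symm
    _ = ∫⁻ x, lreturn (fun h => e h (x h)) π s ∂(Measure.pi fun h => q.map (Y h)) := by
        rw [(iIndepFun_iff_map_fun_eq_pi_map fun h => (hY h).aemeasurable).1 hind]
    _ = lreturn (fun h => meanLayer (he h) (q.map (Y h))) π s := lintegral_lreturn_pi he _ π s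
    _ = lreturn (meanEnv (fun h => (he h).comp (hY h)) q) π s := by
        simp_rw [meanLayer_map _ (hY _)]
        rfl

end MeanReturn

section TrajDensity

variable {S A : Type*} {m : ℕ}

/-- The density `g` at the `i`-th state of a trajectory. It is `1` past the end of the trajectory,
as the state that follows the last layer is not recorded. -/
def stateDens (i : ℕ) (g : S → ℝ≥0∞) (τ : Traj S A m) : ℝ≥0∞ :=
  if hi : i < m then g (τ ⟨i, hi⟩).1 else 1

theorem stateDens_succ_cons (i : ℕ) (g : S → ℝ≥0∞) (y : S × A × ℝ) (τ : Traj S A m) :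
    stateDens (i + 1) g (Fin.cons y τ : Traj S A (m + 1)) = stateDens i g τ := by
  simp only [stateDens, add_lt_add_iff_right]
  rfl

variable [MeasurableSpace S] [MeasurableSpace A] {μS : Measure S} {μA : Measure A}
  {T : Type*} [MeasurableSpace T]

theorem measurable_stateDens (i : ℕ) {g : T → S → ℝ≥0∞}
    (hg : Measurable fun z : T × S => g z.1 z.2) {f : T → Traj S A m} (hf : Measurable f) :
    Measurable fun t => stateDens i (g t) (f t) := by
  unfold stateDens
  split_ifs with hi
  · exact hg.comp (f := fun t => (t, (f t ⟨i, hi⟩).1)) (by fun_prop)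
  · exact measurable_const

/-- The factor of the density of a trajectory that stems from the layer `h` of the environment. -/
noncomputable def layerDens (h : Fin m) (τ : Traj S A m) (e : TransitionFn A μS × RewardFn S A) :
    ℝ≥0∞ :=
  e.2.dens (τ h).1 (τ h).2.1 (τ h).2.2 * stateDens (h + 1) (e.1.dens (τ h).1 (τ h).2.1) τ

theorem layerDens_succ_cons (h : Fin m) (y : S × A × ℝ) (τ : Traj S A m)
    (e : TransitionFn A μS × RewardFn S A) :
    layerDens h.succ (Fin.cons y τ : Traj S A (m + 1)) e = layerDens h τ e := by
  simp only [layerDens, Fin.cons_succ, Fin.val_succ, stateDens_succ_cons]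

theorem layerDens_zero_cons (s : S) (a : A) (x : ℝ) (τ : Traj S A m)
    (e : TransitionFn A μS × RewardFn S A) :
    layerDens 0 (Fin.cons (s, a, x) τ : Traj S A (m + 1)) e =
      e.2.dens s a x * stateDens 0 (e.1.dens s a) τ := by
  simp only [layerDens, Fin.cons_zero, Fin.val_zero, stateDens_succ_cons]

theorem MeasurableLayerFamily.measurable_layerDens {e : T → TransitionFn A μS × RewardFn S A}
    (he : MeasurableLayerFamily e) (h : Fin m) :
    Measurable fun z : T × Traj S A m => layerDens h z.2 (e z.1) :=
  (he.2.comp (f := fun z : T × Traj S A m => (z.1, (z.2 h).1, (z.2 h).2.1, (z.2 h).2.2))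
    (by fun_prop)).mul <| measurable_stateDens _
      (he.1.comp (f := fun z : (T × Traj S A m) × S => (z.1.1, (z.1.2 h).1, (z.1.2 h).2.1, z.2))
        (by fun_prop)) measurable_snd

/-- The factor of the density of a trajectory that stems from the policy. -/
noncomputable def policyDens (π : Policy S μA m) (τ : Traj S A m) : ℝ≥0∞ :=
  ∏ h, (π h).dens (τ h).1 (τ h).2.1

theorem MeasurablePolicyFamily.measurable_policyDens {π : T → Policy S μA m}
    (hπ : MeasurablePolicyFamily π) :
    Measurable fun z : T × Traj S A m => policyDens (π z.1) z.2 :=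
  Finset.measurable_prod _ fun h _ =>
    (hπ h).comp (f := fun z : T × Traj S A m => (z.1, (z.2 h).1, (z.2 h).2.1)) (by fun_prop)

/-- The density of the law of the trajectory with respect to `trajBase`. -/
noncomputable def trajDens (E : Env A μS m) (π : Policy S μA m) (τ : Traj S A m) : ℝ≥0∞ :=
  policyDens π τ * ∏ h, layerDens h τ (E h)

theorem measurable_trajDens {E : T → Env A μS m} {π : T → Policy S μA m}
    (hE : MeasurableEnvFamily E) (hπ : MeasurablePolicyFamily π) :
    Measurable fun z : T × Traj S A m => trajDens (E z.1) (π z.1) z.2 :=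
  hπ.measurable_policyDens.mul <| Finset.measurable_prod _ fun h _ =>
    (hE h).measurable_layerDens h

theorem measurable_trajDens_right (E : Env A μS m) (π : Policy S μA m) :
    Measurable (trajDens E π) :=
  (measurable_trajDens (measurableEnvFamily_const (T := Unit) E)
    (measurablePolicyFamily_const π)).comp (measurable_prodMk_left (x := ()))

theorem trajDens_cons (E : Env A μS (m + 1)) (π : Policy S μA (m + 1)) (s : S) (a : A) (x : ℝ)
    (τ : Traj S A m) :
    trajDens E π (Fin.cons (s, a, x) τ) =
      (π 0).dens s a * ((E 0).2.dens s a x * (stateDens 0 ((E 0).1.dens s a) τ *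
        trajDens (fun j => E j.succ) (fun j => π j.succ) τ)) := by
  simp only [trajDens, policyDens, Fin.prod_univ_succ, layerDens_zero_cons, layerDens_succ_cons,
    Fin.cons_zero, Fin.cons_succ]
  ring

variable [IsProbabilityMeasure μS] [IsProbabilityMeasure μA]

variable (μS A) in
/-- The environment in which states and rewards follow the base measures. -/
def uniformEnv (m : ℕ) : Env A μS m := fun _ =>
  (⟨fun _ _ _ => 1, measurable_const, by simp⟩, ⟨fun _ _ _ => 1, measurable_const, by simp⟩)

variable (S μA) in
/-- The policy that draws actions from the base measure. -/
def uniformPolicy (m : ℕ) : Policy S μA m := fun _ =>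
  ⟨fun _ _ => 1, measurable_const, by simp⟩

variable (μS μA) in
/-- The base measure on trajectories started from a given state. -/
noncomputable def trajBase (m : ℕ) (s : S) : Measure (Traj S A m) :=
  trajLaw (uniformEnv A μS m) (uniformPolicy S μA m) s

theorem isMarkovFamily_trajBase : IsMarkovFamily (trajBase μS μA m) :=
  (isMarkovFamily_trajLaw (measurableEnvFamily_const (T := Unit) (uniformEnv A μS m))
    (measurablePolicyFamily_const (uniformPolicy S μA m))).comp
      (measurable_prodMk_left (x := ()))

instance (s : S) : IsProbabilityMeasure (trajBase μS μA m s) :=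
  isMarkovFamily_trajBase.isProbabilityMeasure s

theorem lintegral_trajBase_succ (s : S) {f : Traj S A (m + 1) → ℝ≥0∞} (hf : Measurable f) :
    ∫⁻ τ, f τ ∂(trajBase μS μA (m + 1) s) =
      ∫⁻ a, ∫⁻ x in Set.Icc (0 : ℝ) 1, ∫⁻ s', ∫⁻ τ, f (Fin.cons (s, a, x) τ)
        ∂(trajBase μS μA m s') ∂μS ∂volume ∂μA := by
  rw [trajBase, lintegral_trajLaw_succ _ _ _ hf, PolicyFn.lintegral_law]
  simp only [RewardFn.lintegral_law, TransitionFn.lintegral_law, uniformEnv, uniformPolicy, one_mul]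
  rfl

theorem lintegral_stateDens_zero_mul (s : S) {g : S → ℝ≥0∞} (hg : Measurable g)
    {f : Traj S A (m + 1) → ℝ≥0∞} (hf : Measurable f) :
    ∫⁻ τ, stateDens 0 g τ * f τ ∂(trajBase μS μA (m + 1) s) =
      g s * ∫⁻ τ, f τ ∂(trajBase μS μA (m + 1) s) := by
  have measurable_integrand : Measurable fun τ : Traj S A (m + 1) => stateDens 0 g τ * f τ :=
    (measurable_stateDens 0 (hg.comp measurable_snd) measurable_id).mul hf
  rw [← lintegral_const_mul _ hf, lintegral_trajBase_succ _ measurable_integrand,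
    lintegral_trajBase_succ _ (hf.const_mul _)]
  rfl

theorem lintegral_transition_trajBase (P : TransitionFn A μS) (s : S) (a : A)
    {f : Traj S A m → ℝ≥0∞} (hf : Measurable f) :
    ∫⁻ s', ∫⁻ τ, f τ ∂(trajBase μS μA m s') ∂(P.law s a) =
      ∫⁻ s', ∫⁻ τ, stateDens 0 (P.dens s a) τ * f τ ∂(trajBase μS μA m s') ∂μS := by
  cases m with
  | zero => simp [trajBase, trajLaw, stateDens]
  | succ m =>
    simp_rw [lintegral_stateDens_zero_mul _ (P.measurable_dens_right s a) hf, P.lintegral_law]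

theorem lintegral_trajLaw (E : Env A μS m) (π : Policy S μA m) (s : S)
    {f : Traj S A m → ℝ≥0∞} (hf : Measurable f) :
    ∫⁻ τ, f τ ∂(trajLaw E π s) = ∫⁻ τ, trajDens E π τ * f τ ∂(trajBase μS μA m s) := by
  induction m generalizing s with
  | zero => simp [trajDens, policyDens, trajBase, trajLaw]
  | succ m ih =>
    let g (z : A × ℝ) (τ : Traj S A m) : ℝ≥0∞ := stateDens 0 ((E 0).1.dens s z.1) τ *
      (trajDens (fun j => E j.succ) (fun j => π j.succ) τ * f (Fin.cons (s, z.1, z.2) τ))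
    have measurable_cons (z : A × ℝ) :
        Measurable fun τ : Traj S A m => f (Fin.cons (s, z.1, z.2) τ) :=
      hf.comp (measurable_finCons.comp measurable_prodMk_left)
    have measurable_g (z : A × ℝ) : Measurable (g z) :=
      (measurable_stateDens 0 (((E 0).1.measurable_dens_right s z.1).comp measurable_snd)
        measurable_id).mul ((measurable_trajDens_right _ _).mul (measurable_cons z))
    have lintegral_tail (z : A × ℝ) :
        ∫⁻ s', ∫⁻ τ, f (Fin.cons (s, z.1, z.2) τ)
            ∂(trajLaw (fun j => E j.succ) (fun j => π j.succ) s') ∂((E 0).1.law s z.1) =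
          ∫⁻ s', ∫⁻ τ, g z τ ∂(trajBase μS μA m s') ∂μS := by
      simp_rw [ih _ _ _ (measurable_cons z)]
      exact lintegral_transition_trajBase _ s z.1
        ((measurable_trajDens_right _ _).mul (measurable_cons z))
    have lintegral_const_mul_g (c : ℝ≥0∞) (z : A × ℝ) :
        ∫⁻ s', ∫⁻ τ, c * g z τ ∂(trajBase μS μA m s') ∂μS =
          c * ∫⁻ s', ∫⁻ τ, g z τ ∂(trajBase μS μA m s') ∂μS := by
      simp_rw [lintegral_const_mul _ (measurable_g z)]
      exact lintegral_const_mul _ (isMarkovFamily_trajBase.measurable_lintegral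
        (f := fun _ τ => g z τ) ((measurable_g z).comp measurable_snd))
    have trajDens_mul_cons (z : A × ℝ) (τ : Traj S A m) :
        trajDens E π (Fin.cons (s, z.1, z.2) τ) * f (Fin.cons (s, z.1, z.2) τ) =
          (π 0).dens s z.1 * (E 0).2.dens s z.1 z.2 * g z τ := by
      simp only [trajDens_cons, g]
      ring
    have measurable_trajDens_mul : Measurable fun τ => trajDens E π τ * f τ :=
      (measurable_trajDens_right E π).mul hf
    rw [lintegral_trajLaw_succ E π s hf, lintegral_trajBase_succ s measurable_trajDens_mul,
      PolicyFn.lintegral_law]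
    refine lintegral_congr_ae ?_
    filter_upwards [ae_lt_top ((π 0).measurable_dens_right s)
      (((π 0).lintegral_dens s).trans_ne ENNReal.one_ne_top)] with a ha
    rw [RewardFn.lintegral_law, ← lintegral_const_mul' _ _ ha.ne]
    refine lintegral_congr fun x => ?_
    rw [lintegral_tail (a, x), ← mul_assoc, ← lintegral_const_mul_g]
    exact lintegral_congr fun s' => lintegral_congr fun τ => (trajDens_mul_cons (a, x) τ).symm

theorem trajLaw_eq_withDensity (E : Env A μS m) (π : Policy S μA m) (s : S) :
    trajLaw E π s = (trajBase μS μA m s).withDensity (trajDens E π) := by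
  refine Measure.ext_of_lintegral _ fun f hf => ?_
  rw [lintegral_trajLaw E π s hf,
    lintegral_withDensity_eq_lintegral_mul _ (measurable_trajDens_right E π) hf]
  rfl

end TrajDensity

section Bayes

variable {D D' T Y : Type*} [MeasurableSpace D] [MeasurableSpace D'] [MeasurableSpace T]
  [MeasurableSpace Y] {ν : Measure D} {ρ : Measure T} [SFinite ρ]

theorem map_withDensity_apply {β : Measure Y} {L : Y → ℝ≥0∞} (hL : Measurable L)
    {g : Y → D} (hg : Measurable g) {s : Set D} (hs : MeasurableSet s) :
    (β.withDensity L).map g s = ∫⁻ y, L y * s.indicator 1 (g y) ∂β := by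
  rw [← lintegral_indicator_one hs, lintegral_map (measurable_one.indicator hs) hg]
  exact lintegral_withDensity_eq_lintegral_mul _ hL ((measurable_one.indicator hs).comp hg)

theorem measurable_map_withDensity {β : Measure Y} [SFinite β] {L : D → Y → ℝ≥0∞}
    (hL : Measurable fun z : D × Y => L z.1 z.2) {g : D → Y → D'}
    (hg : Measurable fun z : D × Y => g z.1 z.2) :
    Measurable fun d => (β.withDensity (L d)).map (g d) := by
  refine Measure.measurable_of_measurable_coe _ fun s hs => ?_
  have map_apply (d : D) : (β.withDensity (L d)).map (g d) s =
      ∫⁻ y, L d y * s.indicator 1 (g d y) ∂β :=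
    map_withDensity_apply (hL.comp measurable_prodMk_left) (hg.comp measurable_prodMk_left) hs
  simp_rw [map_apply]
  exact (hL.mul ((measurable_one.indicator hs).comp hg)).lintegral_prod_right'

theorem withDensity_bind_map_withDensity {β : Measure Y} [SFinite β] {p : D × T → ℝ≥0∞}
    (hp : Measurable p) {L : D × T → Y → ℝ≥0∞}
    (hL : Measurable fun w : (D × T) × Y => L w.1 w.2) {g : D × Y → D'} (hg : Measurable g)
    {f : D' × T → ℝ≥0∞} (hf : Measurable f)
    (hfpL : ∀ d t y, f (g (d, y), t) = p (d, t) * L (d, t) y) :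
    (((ν.prod ρ).withDensity p).bind fun z =>
        (β.withDensity (L z)).map fun y => (g (z.1, y), z.2)) =
      (((ν.prod β).map g).prod ρ).withDensity f := by
  let η (z : D × T) : Measure (D' × T) := (β.withDensity (L z)).map fun y => (g (z.1, y), z.2)
  let F (s : Set (D' × T)) (z : D × T) (y : Y) : ℝ≥0∞ := L z y * s.indicator 1 (g (z.1, y), z.2)
  have η_apply (z : D × T) {s : Set (D' × T)} (hs : MeasurableSet s) : η z s = ∫⁻ y, F s z y ∂β :=
    map_withDensity_apply (hL.comp measurable_prodMk_left) (by fun_prop) hs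
  have measurable_F {s : Set (D' × T)} (hs : MeasurableSet s) :
      Measurable fun w : (D × T) × Y => F s w.1 w.2 :=
    hL.mul ((measurable_one.indicator hs).comp
      (g := fun x : D' × T => s.indicator (1 : D' × T → ℝ≥0∞) x) (by fun_prop))
  have measurable_η : Measurable η :=
    measurable_map_withDensity (D := D × T) (g := fun z y => (g (z.1, y), z.2)) hL (by fun_prop)
  have p_mul_F (s : Set (D' × T)) (d : D) (t : T) (y : Y) :
      p (d, t) * F s (d, t) y = s.indicator f (g (d, y), t) := by
    by_cases h : (g (d, y), t) ∈ s <;> simp [F, h, hfpL]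
  refine Measure.ext fun s hs => ?_
  have measurable_section (d : D) : Measurable fun z : T × Y => s.indicator f (g (d, z.2), z.1) :=
    (hf.indicator hs).comp (by fun_prop)
  calc ((ν.prod ρ).withDensity p).bind η s
    _ = ∫⁻ z, p z * ∫⁻ y, F s z y ∂β ∂(ν.prod ρ) := by
      rw [Measure.bind_apply hs measurable_η.aemeasurable]
      simp_rw [η_apply _ hs]
      exact lintegral_withDensity_eq_lintegral_mul _ hp (measurable_F hs).lintegral_prod_right'
    _ = ∫⁻ d, ∫⁻ t, ∫⁻ y, s.indicator f (g (d, y), t) ∂β ∂ρ ∂ν := by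
      refine (lintegral_prod _ (hp.mul (measurable_F hs).lintegral_prod_right').aemeasurable).trans
        (lintegral_congr fun d => lintegral_congr fun t => ?_)
      simp only [Pi.mul_apply, ← p_mul_F]
      exact (lintegral_const_mul _ ((measurable_F hs).comp measurable_prodMk_left)).symm
    _ = ∫⁻ d, ∫⁻ y, ∫⁻ t, s.indicator f (g (d, y), t) ∂ρ ∂β ∂ν :=
      lintegral_congr fun d => lintegral_lintegral_swap (measurable_section d).aemeasurable
    _ = (((ν.prod β).map g).prod ρ).withDensity f s := by
      have measurable_indicator := hf.indicator hs
      have measurable_lintegral := measurable_indicator.lintegral_prod_right' (ν := ρ)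
      rw [withDensity_apply _ hs, ← lintegral_indicator hs,
        lintegral_prod _ measurable_indicator.aemeasurable, lintegral_map measurable_lintegral hg]
      exact (lintegral_prod _ (measurable_lintegral.comp hg).aemeasurable).symm

theorem fst_prod_withDensity [SFinite ν] {p : D × T → ℝ≥0∞} (hp : Measurable p) :
    ((ν.prod ρ).withDensity p).fst = ν.withDensity fun d => ∫⁻ t, p (d, t) ∂ρ := by
  refine Measure.ext fun s hs => ?_
  rw [Measure.fst_apply hs, withDensity_apply _ (measurable_fst hs), withDensity_apply _ hs,
    ← Set.prod_univ, ← Measure.prod_restrict, Measure.restrict_univ,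
    lintegral_prod _ hp.aemeasurable]

theorem ae_lintegral_mul_inv_mul {p : D → T → ℝ≥0∞} (hp : Measurable fun z : D × T => p z.1 z.2)
    (hp' : ∀ᵐ d ∂ν, ∫⁻ t, p d t ∂ρ < ∞) :
    ∀ᵐ z ∂(ν.prod ρ), (∫⁻ t, p z.1 t ∂ρ) * ((∫⁻ t, p z.1 t ∂ρ)⁻¹ * p z.1 z.2) = p z.1 z.2 := by
  have measurable_lintegral : Measurable fun z : D × T => ∫⁻ t, p z.1 t ∂ρ :=
    hp.lintegral_prod_right'.comp measurable_fst
  refine (Measure.ae_prod_iff_ae_ae (measurableSet_eq_fun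
    (measurable_lintegral.mul (measurable_lintegral.inv.mul hp)) hp)).2 ?_
  filter_upwards [hp'] with d hd
  rcases eq_or_ne (∫⁻ t, p d t ∂ρ) 0 with hd0 | hd0
  · filter_upwards [(lintegral_eq_zero_iff (hp.comp measurable_prodMk_left)).1 hd0] with t ht
    simpa [hd0] using ht.symm
  · exact ae_of_all _ fun t => ENNReal.mul_inv_cancel_left hd0 hd.ne

theorem ae_eq_smul_withDensity_of_withDensity_eq_compProd [SFinite ν]
    [MeasurableSpace.CountableOrCountablyGenerated D T] {p : D → T → ℝ≥0∞}
    (hp : Measurable fun z : D × T => p z.1 z.2) {μ : Measure D} [IsFiniteMeasure μ]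
    {κ : Kernel D T} [IsMarkovKernel κ]
    (hκ : (ν.prod ρ).withDensity (fun z => p z.1 z.2) = μ ⊗ₘ κ) :
    ∀ᵐ d ∂μ, κ d = (∫⁻ t, p d t ∂ρ)⁻¹ • ρ.withDensity (p d) := by
  let b (d : D) : ℝ≥0∞ := ∫⁻ t, p d t ∂ρ
  have measurable_b : Measurable b := hp.lintegral_prod_right'
  have hμ : μ = ν.withDensity b := by rw [← Measure.fst_compProd μ κ, ← hκ, fst_prod_withDensity hp]
  have b_lt_top : ∀ᵐ d ∂ν, b d < ∞ := by
    refine ae_lt_top measurable_b ?_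
    rw [← setLIntegral_univ, ← withDensity_apply _ .univ, ← hμ]
    exact measure_ne_top _ _
  let g (d : D) (t : T) : ℝ≥0∞ := (b d)⁻¹ * p d t
  have measurable_g : Measurable fun z : D × T => g z.1 z.2 :=
    (measurable_b.inv.comp measurable_fst).mul hp
  let κ' : Kernel D T := (Kernel.const D ρ).withDensity g
  have κ'_apply (d : D) : κ' d = (b d)⁻¹ • ρ.withDensity (p d) :=
    (Kernel.withDensity_apply _ measurable_g d).trans
      (withDensity_smul _ (hp.comp measurable_prodMk_left))
  have : IsFiniteKernel κ' := ⟨1, ENNReal.one_lt_top, fun d => by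
    rw [κ'_apply, Measure.smul_apply, withDensity_apply _ .univ, setLIntegral_univ]
    exact ENNReal.inv_mul_le_one _⟩
  have compProd_κ' : μ ⊗ₘ κ' = μ ⊗ₘ κ :=
    calc μ ⊗ₘ κ'
      _ = ((ν.prod ρ).withDensity fun z => b z.1).withDensity fun z => g z.1 z.2 := by
        rw [Measure.compProd_withDensity measurable_g, Measure.compProd_const, hμ,
          prod_withDensity_left measurable_b]
      _ = (ν.prod ρ).withDensity fun z => b z.1 * g z.1 z.2 :=
        (withDensity_mul _ (measurable_b.comp measurable_fst) measurable_g).symm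
      _ = μ ⊗ₘ κ := by rw [withDensity_congr_ae (ae_lintegral_mul_inv_mul hp b_lt_top), hκ]
  filter_upwards [Kernel.ae_eq_of_compProd_eq compProd_κ'] with d hd
  rw [← hd, κ'_apply]

end Bayes

theorem countablyGenerated_pi {ι : Type*} [Countable ι] {X : ι → Type*}
    [∀ i, MeasurableSpace (X i)] [h : ∀ i, MeasurableSpace.CountablyGenerated (X i)] :
    MeasurableSpace.CountablyGenerated (∀ i, X i) := by
  choose b hb hgen using fun i => (h i).isCountablyGenerated
  refine ⟨⋃ i, Set.preimage (fun x : ∀ i, X i => x i) '' b i,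
    Set.countable_iUnion fun i => (hb i).image _, ?_⟩
  rw [← MeasurableSpace.iSup_generateFrom]
  refine iSup_congr fun i => ?_
  rw [← MeasurableSpace.comap_generateFrom, ← hgen i]

namespace BayesianRL

variable {S A : Type*} [MeasurableSpace S] [MeasurableSpace A] {H : ℕ} (M : BayesianRL S A H)

instance isProbabilityMeasure_prior : IsProbabilityMeasure M.prior := by
  unfold prior; infer_instance

section Likelihood

variable {n : ℕ}

/-- The factor of the likelihood of a history that stems from the layer `h` of the environment. -/
noncomputable def layerLikelihood (h : Fin H) (d : M.Hist n) (e : M.ΘP h × M.ΘR h) : ℝ≥0∞ :=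
  ∏ i, layerDens h (d i) (M.layer h e)

/-- The likelihood of an environment given a history, up to the factors that stem from the
policies. -/
noncomputable def likelihood (d : M.Hist n) (θ : M.Θ) : ℝ≥0∞ :=
  ∏ h, M.layerLikelihood h d (θ h)

theorem measurable_layerLikelihood (h : Fin H) :
    Measurable fun z : M.Hist n × (M.ΘP h × M.ΘR h) => M.layerLikelihood h z.1 z.2 :=
  Finset.measurable_prod _ fun i _ =>
    ((M.measurableLayerFamily_layer h).measurable_layerDens h).comp
      (f := fun z : M.Hist n × (M.ΘP h × M.ΘR h) => (z.2, z.1 i)) (by fun_prop)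

theorem measurable_likelihood : Measurable fun z : M.Hist n × M.Θ => M.likelihood z.1 z.2 :=
  Finset.measurable_prod _ fun h _ => (M.measurable_layerLikelihood h).comp
    (f := fun z : M.Hist n × M.Θ => (z.1, z.2 h)) (by fun_prop)

theorem measurable_likelihood_right (d : M.Hist n) : Measurable (M.likelihood d) :=
  M.measurable_likelihood.comp (f := fun θ => (d, θ)) (by fun_prop)

theorem likelihood_snoc (d : M.Hist n) (τ : Traj S A H) (θ : M.Θ) :
    M.likelihood (Fin.snoc d τ : M.Hist (n + 1)) θ =
      M.likelihood d θ * ∏ h, layerDens h τ (M.env θ h) := by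
  simp only [likelihood, layerLikelihood, Fin.prod_univ_castSucc, Fin.snoc_castSucc, Fin.snoc_last,
    Finset.prod_mul_distrib]
  rfl

end Likelihood

/-- The density of the actions in an episode of Thompson sampling, when the environment is sampled
from `q`. -/
noncomputable def samplingDens (q : Measure M.Θ) (τ : Traj S A H) : ℝ≥0∞ :=
  ∫⁻ θ', policyDens (M.opt θ') τ ∂q

theorem bind_trajLaw_opt (q : Measure M.Θ) [SFinite q] (E : Env A M.μS H) :
    (q.bind fun θ' => trajLaw E (M.opt θ') M.s₁) =
      (trajBase M.μS M.μA H M.s₁).withDensity fun τ =>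
        M.samplingDens q τ * ∏ h, layerDens h τ (E h) := by
  simp_rw [trajLaw_eq_withDensity]
  rw [bind_withDensity (measurable_trajDens (measurableEnvFamily_const E)
    M.measurablePolicyFamily_opt)]
  congr 1 with τ
  exact lintegral_mul_const _
    (M.measurablePolicyFamily_opt.measurable_policyDens.comp measurable_prodMk_right)

variable {M} {Q : ∀ n, Kernel (M.Hist n) M.Θ}

theorem measurable_samplingDens {n : ℕ} [IsMarkovKernel (Q n)] :
    Measurable fun z : M.Hist n × Traj S A H => M.samplingDens (Q n z.1) z.2 :=
  Measurable.lintegral_kernel_prod_right' (κ := (Q n).comap Prod.fst measurable_fst)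
    (f := fun u : (M.Hist n × Traj S A H) × M.Θ => policyDens (M.opt u.2) u.1.2)
    (M.measurablePolicyFamily_opt.measurable_policyDens.comp
      (f := fun u : (M.Hist n × Traj S A H) × M.Θ => (u.2, u.1.2)) (by fun_prop))

theorem isMarkovFamily_trajLaw_opt :
    IsMarkovFamily fun z : M.Θ × M.Θ => trajLaw (M.env z.1) (M.opt z.2) M.s₁ :=
  (isMarkovFamily_trajLaw (M.measurableEnvFamily_env.comp measurable_fst)
    (M.measurablePolicyFamily_opt.comp measurable_snd)).comp
      (g := fun z : M.Θ × M.Θ => (z, M.s₁)) (by fun_prop)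

theorem isProbabilityMeasure_jointLaw (hQ : ∀ n, IsMarkovKernel (Q n)) (n : ℕ) :
    IsProbabilityMeasure (M.jointLaw Q n) := by
  induction n with
  | zero => exact Measure.isProbabilityMeasure_map (by fun_prop)
  | succ n ih =>
    have posterior_family : IsMarkovFamily (Q n) :=
      ⟨(Q n).measurable, (hQ n).isProbabilityMeasure⟩
    have episode_family : IsMarkovFamily fun z : M.Hist n × M.Θ =>
        (Q n z.1).bind fun θ' => (trajLaw (M.env z.2) (M.opt θ') M.s₁).map fun τ =>
          ((Fin.snoc z.1 τ : M.Hist (n + 1)), z.2) := by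
      refine (posterior_family.comp measurable_fst).bind (.map (isMarkovFamily_trajLaw_opt.comp
        (g := fun w : (M.Hist n × M.Θ) × M.Θ => (w.1.2, w.2)) (by fun_prop)) ?_)
      exact (measurable_finSnoc.comp (f := fun w : ((M.Hist n × M.Θ) × M.Θ) × Traj S A H =>
        (w.1.1.1, w.2)) (by fun_prop)).prodMk (by fun_prop)
    exact isProbabilityMeasure_bind episode_family.measurable.aemeasurable
      (ae_of_all _ episode_family.isProbabilityMeasure)

theorem jointLaw_succ (n : ℕ) [IsMarkovKernel (Q n)] :
    M.jointLaw Q (n + 1) = (M.jointLaw Q n).bind fun z =>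
      ((trajBase M.μS M.μA H M.s₁).withDensity fun τ =>
        M.samplingDens (Q n z.1) τ * ∏ h, layerDens h τ (M.env z.2 h)).map fun τ =>
          ((Fin.snoc z.1 τ : M.Hist (n + 1)), z.2) := by
  refine congrArg _ (funext fun z => ?_)
  have measurable_snoc : Measurable fun τ => ((Fin.snoc z.1 τ : M.Hist (n + 1)), z.2) :=
    (measurable_finSnoc.comp measurable_prodMk_left).prodMk measurable_const
  have measurable_episode : Measurable fun θ' => trajLaw (M.env z.2) (M.opt θ') M.s₁ :=
    isMarkovFamily_trajLaw_opt.measurable.comp measurable_prodMk_left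
  rw [← bind_trajLaw_opt]
  simp_rw [← Measure.bind_dirac_eq_map _ measurable_snoc]
  exact (Measure.bind_bind measurable_episode.aemeasurable
    (Measure.measurable_dirac.comp measurable_snoc).aemeasurable).symm

theorem exists_jointLaw_eq_withDensity (hQ : ∀ n, IsMarkovKernel (Q n)) (n : ℕ) :
    ∃ (ν : Measure (M.Hist n)) (c : M.Hist n → ℝ≥0∞), IsProbabilityMeasure ν ∧ Measurable c ∧
      M.jointLaw Q n = (ν.prod M.prior).withDensity fun z => c z.1 * M.likelihood z.1 z.2 := by
  induction n with
  | zero =>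
    refine ⟨Measure.dirac Fin.elim0, 1, inferInstance, measurable_one, ?_⟩
    simp only [likelihood, layerLikelihood, Fin.prod_univ_zero, Pi.one_apply, Finset.prod_const_one,
      mul_one, ← Pi.one_def, withDensity_one, Measure.dirac_prod]
    rfl
  | succ n ih =>
    obtain ⟨ν, c, hν, measurable_c, hlaw⟩ := ih
    have measurable_layers :
        Measurable fun z : M.Θ × Traj S A H => ∏ h, layerDens h z.2 (M.env z.1 h) :=
      Finset.measurable_prod _ fun h _ => (M.measurableEnvFamily_env h).measurable_layerDens h
    let c' (d : M.Hist (n + 1)) : ℝ≥0∞ :=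
      c (Fin.init d) * M.samplingDens (Q n (Fin.init d)) (d (Fin.last n))
    have measurable_c' : Measurable c' := by
      have measurable_init : Measurable (Fin.init : M.Hist (n + 1) → M.Hist n) :=
        measurable_pi_lambda _ fun i => measurable_pi_apply _
      exact (measurable_c.comp measurable_init).mul (measurable_samplingDens.comp
        (measurable_init.prodMk (measurable_pi_apply (Fin.last n))))
    refine ⟨(ν.prod (trajBase M.μS M.μA H M.s₁)).map fun z => Fin.snoc z.1 z.2, c',
      Measure.isProbabilityMeasure_map measurable_finSnoc.aemeasurable, measurable_c', ?_⟩
    rw [jointLaw_succ, hlaw]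
    refine withDensity_bind_map_withDensity
      (p := fun z : M.Hist n × M.Θ => c z.1 * M.likelihood z.1 z.2)
      (g := fun z : M.Hist n × Traj S A H => (Fin.snoc z.1 z.2 : M.Hist (n + 1)))
      (L := fun z τ => M.samplingDens (Q n z.1) τ * ∏ h, layerDens h τ (M.env z.2 h))
      (f := fun z => c' z.1 * M.likelihood z.1 z.2)
      ((measurable_c.comp measurable_fst).mul M.measurable_likelihood) ?_ measurable_finSnoc
      ((measurable_c'.comp measurable_fst).mul M.measurable_likelihood) fun d θ τ => ?_
    · exact (measurable_samplingDens.comp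
        (f := fun w : (M.Hist n × M.Θ) × Traj S A H => (w.1.1, w.2)) (by fun_prop)).mul
        (measurable_layers.comp
          (f := fun w : (M.Hist n × M.Θ) × Traj S A H => (w.1.2, w.2)) (by fun_prop))
    · simp only [c', Fin.init_snoc, Fin.snoc_last, likelihood_snoc]
      ring

theorem IsPosterior.isProbabilityMeasure_histLaw (hQ : M.IsPosterior Q) (n : ℕ) :
    IsProbabilityMeasure (M.histLaw Q n) := by
  have := isProbabilityMeasure_jointLaw (fun n => (hQ n).1) n
  exact inferInstanceAs (IsProbabilityMeasure (M.jointLaw Q n).fst)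

theorem IsPosterior.ae_eq_smul_withDensity (hQ : M.IsPosterior Q) (n : ℕ) :
    ∀ᵐ d ∂(M.histLaw Q n), ∃ C : ℝ≥0∞, Q n d = C • M.prior.withDensity (M.likelihood d) := by
  have := (hQ n).1
  have : MeasurableSpace.CountablyGenerated M.Θ := countablyGenerated_pi
  have := hQ.isProbabilityMeasure_histLaw n
  obtain ⟨ν, c, hν, measurable_c, hlaw⟩ := exists_jointLaw_eq_withDensity (fun n => (hQ n).1) n
  have measurable_p : Measurable fun z : M.Hist n × M.Θ => c z.1 * M.likelihood z.1 z.2 :=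
    (measurable_c.comp measurable_fst).mul M.measurable_likelihood
  have hcompProd : (ν.prod M.prior).withDensity (fun z => c z.1 * M.likelihood z.1 z.2) =
      M.histLaw Q n ⊗ₘ Q n := hlaw.symm.trans (hQ n).2
  have bayes := ae_eq_smul_withDensity_of_withDensity_eq_compProd
    (p := fun d θ => c d * M.likelihood d θ) measurable_p hcompProd
  refine bayes.mono fun d hd => ⟨(∫⁻ θ, c d * M.likelihood d θ ∂M.prior)⁻¹ * c d, ?_⟩
  have withDensity_const_mul :
      M.prior.withDensity (fun θ => c d * M.likelihood d θ) =
        c d • M.prior.withDensity (M.likelihood d) :=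
    withDensity_smul (c d) (M.measurable_likelihood_right d)
  rw [hd, withDensity_const_mul, smul_smul]

end BayesianRL

section Tilting

variable {Ω ι : Type*} [Fintype ι] {β : ι → Type*} {mΩ : MeasurableSpace Ω}
  [∀ i, MeasurableSpace (β i)] {X : ∀ i, Ω → β i} {μ q : Measure Ω}

theorem iIndepFun_of_measure_iInter_preimage_eq_mul_prod [IsProbabilityMeasure q]
    (hX : ∀ i, Measurable (X i)) {C : ℝ≥0∞} {w : ∀ i, Set (β i) → ℝ≥0∞}
    (hq : ∀ s : ∀ i, Set (β i), (∀ i, MeasurableSet (s i)) →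
      q (⋂ i, X i ⁻¹' s i) = C * ∏ i, w i (s i)) :
    iIndepFun X q := by
  classical
  have total_mass : C * ∏ i, w i Set.univ = 1 := by
    simpa using (hq (fun _ => Set.univ) fun _ => .univ).symm
  have w_univ_ne_zero (i : ι) : w i Set.univ ≠ 0 := fun hi => by
    rw [Finset.prod_eq_zero (Finset.mem_univ i) hi, mul_zero] at total_mass
    exact zero_ne_one total_mass
  have measure_preimage (i : ι) {s : Set (β i)} (hs : MeasurableSet s) :
      q (X i ⁻¹' s) = (w i Set.univ)⁻¹ * w i s := by
    have complement_mass : C * ∏ j ∈ Finset.univ.erase i, w j Set.univ = (w i Set.univ)⁻¹ := by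
      refine ENNReal.eq_inv_of_mul_eq_one_left ?_
      rw [mul_assoc, Finset.prod_erase_mul _ _ (Finset.mem_univ i), total_mass]
    let t : ∀ j, Set (β j) := Function.update (fun _ => Set.univ) i s
    have t_self : t i = s := Function.update_self ..
    have t_of_ne {j : ι} (hj : j ≠ i) : t j = Set.univ := Function.update_of_ne hj ..
    have measurableSet_t (j : ι) : MeasurableSet (t j) := by
      obtain rfl | hj := eq_or_ne j i
      · rwa [t_self]
      · rw [t_of_ne hj]; exact .univ
    have iInter_t : ⋂ j, X j ⁻¹' t j = X i ⁻¹' s := by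
      refine Set.Subset.antisymm (t_self ▸ Set.iInter_subset _ i) (Set.subset_iInter fun j => ?_)
      obtain rfl | hj := eq_or_ne j i
      · rw [t_self]
      · rw [t_of_ne hj]; exact Set.subset_univ _
    rw [← iInter_t, hq t measurableSet_t, ← Finset.mul_prod_erase _ _ (Finset.mem_univ i), t_self,
      Finset.prod_congr rfl fun j hj => by rw [t_of_ne (Finset.ne_of_mem_erase hj)],
      mul_left_comm, complement_mass, mul_comm]
  refine (iIndepFun_iff_map_fun_eq_pi_map fun i => (hX i).aemeasurable).2
    (Measure.pi_eq fun s hs => ?_).symm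
  have C_eq : C = ∏ i, (w i Set.univ)⁻¹ := by
    rw [← ENNReal.prod_inv_distrib fun i _ j _ _ => Or.inl (w_univ_ne_zero i)]
    exact ENNReal.eq_inv_of_mul_eq_one_left total_mass
  rw [Measure.map_apply (measurable_pi_iff.2 hX) (.univ_pi hs)]
  simp_rw [Measure.map_apply (hX _) (hs _), measure_preimage _ (hs _)]
  rw [Finset.prod_mul_distrib, ← C_eq, ← hq s hs]
  congr 1 with ω
  simp

theorem iIndepFun_of_eq_smul_withDensity_prod [IsProbabilityMeasure q] (hX : ∀ i, Measurable (X i))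
    (hind : iIndepFun X μ) {L : ∀ i, β i → ℝ≥0∞} (hL : ∀ i, Measurable (L i)) {C : ℝ≥0∞}
    (hq : q = C • μ.withDensity fun ω => ∏ i, L i (X i ω)) : iIndepFun X q := by
  refine iIndepFun_of_measure_iInter_preimage_eq_mul_prod hX (C := C)
    (w := fun i s => ∫⁻ ω, s.indicator (L i) (X i ω) ∂μ) fun s hs => ?_
  have indicator_prod (ω : Ω) : (⋂ i, X i ⁻¹' s i).indicator (fun ω => ∏ i, L i (X i ω)) ω =
      ∏ i, (s i).indicator (L i) (X i ω) := by
    by_cases hω : ω ∈ ⋂ i, X i ⁻¹' s i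
    · rw [Set.indicator_of_mem hω]
      exact Finset.prod_congr rfl fun i _ =>
        (Set.indicator_of_mem (s := s i) (Set.mem_iInter.1 hω i) _).symm
    · rw [Set.indicator_of_notMem hω]
      obtain ⟨i, hi⟩ : ∃ i, X i ω ∉ s i := by simpa using hω
      exact (Finset.prod_eq_zero (Finset.mem_univ i) (Set.indicator_of_notMem hi _)).symm
  have measurableSet_iInter : MeasurableSet (⋂ i, X i ⁻¹' s i) := .iInter fun i => hX i (hs i)
  rw [hq, Measure.smul_apply, smul_eq_mul, withDensity_apply _ measurableSet_iInter,
    ← lintegral_indicator measurableSet_iInter]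
  simp_rw [indicator_prod]
  exact congrArg (C * ·) (lintegral_prod_eq_prod_lintegral_of_indepFun Finset.univ _
    (hind.comp _ fun i => (hL i).indicator (hs i))
    fun i => ((hL i).indicator (hs i)).comp (hX i))

theorem cond_eq_smul_withDensity_cond [IsFiniteMeasure μ] {C : ℝ≥0∞} {f : Ω → ℝ≥0∞}
    (hq : q = C • μ.withDensity f) {s : Set Ω} (hs : MeasurableSet s) (hμs : μ s ≠ 0) :
    q[|s] = ((q s)⁻¹ * C * μ s) • (μ[|s]).withDensity f := by
  have restrict_q : q.restrict s = C • (μ.restrict s).withDensity f := by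
    rw [hq, Measure.restrict_smul, restrict_withDensity hs]
  have restrict_μ : μ.restrict s = μ s • μ[|s] := by
    rw [ProbabilityTheory.cond, smul_smul, ENNReal.mul_inv_cancel hμs (measure_ne_top _ _),
      one_smul]
  rw [ProbabilityTheory.cond, restrict_q, restrict_μ, withDensity_smul_measure, smul_smul,
    smul_smul, mul_assoc]

end Tilting

namespace BayesianRL

variable {S A : Type*} [MeasurableSpace S] [MeasurableSpace A] {H : ℕ} {M : BayesianRL S A H}

theorem IsLayered.iIndepFun_cond {n K : ℕ} {ζ : M.Θ → Fin K} (hlayered : M.IsLayered ζ)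
    (hζ : Measurable ζ) {d : M.Hist n} {q : Measure M.Θ} [IsProbabilityMeasure q] {C : ℝ≥0∞}
    (hq : q = C • M.prior.withDensity (M.likelihood d)) {k : Fin K} (hk : q (ζ ⁻¹' {k}) ≠ 0) :
    iIndepFun (fun (h : Fin H) (θ : M.Θ) => θ h) (q[|ζ ⁻¹' {k}]) := by
  have measurableSet_cell : MeasurableSet (ζ ⁻¹' {k}) := hζ (measurableSet_singleton k)
  have prior_cell : M.prior (ζ ⁻¹' {k}) ≠ 0 := fun h => hk (by
    rw [hq, Measure.smul_apply, withDensity_absolutelyContinuous _ _ h, smul_zero])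
  have := cond_isProbabilityMeasure hk
  exact iIndepFun_of_eq_smul_withDensity_prod measurable_pi_apply (hlayered k prior_cell)
    (fun h => (M.measurable_layerLikelihood h).comp (measurable_prodMk_left (x := d)))
    (cond_eq_smul_withDensity_cond hq measurableSet_cell prior_cell)

end BayesianRL

section Selection

variable {D T : Type*} [MeasurableSpace D] [MeasurableSpace T]

theorem ae_infinitePi_exists_mem {ρ : Measure T} [IsProbabilityMeasure ρ] {s : Set T}
    (hs : MeasurableSet s) (hρs : ρ s ≠ 0) :
    ∀ᵐ u ∂(Measure.infinitePi fun _ : ℕ => ρ), ∃ i, u i ∈ s := by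
  have compl_lt_one : ρ sᶜ < 1 := by
    rw [prob_compl_eq_one_sub hs]
    exact ENNReal.sub_lt_self ENNReal.one_ne_top one_ne_zero hρs
  have miss_le (n : ℕ) :
      (Measure.infinitePi fun _ : ℕ => ρ) {u | ¬∃ i, u i ∈ s} ≤ ρ sᶜ ^ n := by
    have measure_pi := Measure.infinitePi_pi (fun _ : ℕ => ρ) (s := Finset.range n)
      (t := fun _ => sᶜ) fun _ _ => hs.compl
    rw [Finset.prod_const, Finset.card_range] at measure_pi
    rw [← measure_pi]
    exact measure_mono fun u hu i _ hi => hu ⟨i, hi⟩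
  exact nonpos_iff_eq_zero.1
    (ge_of_tendsto' (ENNReal.tendsto_pow_atTop_nhds_zero_of_lt_one compl_lt_one) miss_le)

theorem exists_seq_ae_exists_mem (ν : Measure D) [SFinite ν] (ρ : Measure T)
    [IsProbabilityMeasure ρ] {B : Set (D × T)} (hB : MeasurableSet B) :
    ∃ u : ℕ → T, ∀ᵐ d ∂ν, ρ (Prod.mk d ⁻¹' B) ≠ 0 → ∃ i, (d, u i) ∈ B := by
  have measurableSet_good : MeasurableSet {z : (ℕ → T) × D |
      ρ (Prod.mk z.2 ⁻¹' B) ≠ 0 → ∃ i, (z.2, z.1 i) ∈ B} := by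
    have measurableSet_pos : MeasurableSet {z : (ℕ → T) × D | ρ (Prod.mk z.2 ⁻¹' B) ≠ 0} :=
      measurable_snd (measurable_measure_prodMk_left hB (measurableSet_singleton 0).compl)
    have measurableSet_hit (i : ℕ) : MeasurableSet {z : (ℕ → T) × D | (z.2, z.1 i) ∈ B} :=
      (show Measurable fun z : (ℕ → T) × D => (z.2, z.1 i) by fun_prop) hB
    simp_rw [imp_iff_not_or, Set.ofPred_or, Set.ofPred_exists]
    exact measurableSet_pos.compl.union (.iUnion measurableSet_hit)
  refine Filter.Eventually.exists (f := ae (Measure.infinitePi fun _ : ℕ => ρ)) ?_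
  refine (Measure.ae_ae_comm measurableSet_good).2 (ae_of_all _ fun d => ?_)
  by_cases hd : ρ (Prod.mk d ⁻¹' B) = 0
  · exact ae_of_all _ fun u h => absurd hd h
  · exact (ae_infinitePi_exists_mem (measurable_prodMk_left hB) hd).mono fun u hu _ => hu

theorem exists_measurable_selection (ν : Measure D) [SFinite ν] (ρ : Measure T)
    [IsProbabilityMeasure ρ] {B : Set (D × T)} (hB : MeasurableSet B) (t₀ : T) :
    ∃ f : D → T, Measurable f ∧ (∀ d, f d = t₀ ∨ (d, f d) ∈ B) ∧
      ∀ᵐ d ∂ν, ρ (Prod.mk d ⁻¹' B) ≠ 0 → (d, f d) ∈ B := by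
  classical
  obtain ⟨u, hu⟩ := exists_seq_ae_exists_mem ν ρ hB
  let hit (d : D) : Prop := ∃ i, (d, u i) ∈ B
  have measurableSet_hit_at (i : ℕ) : MeasurableSet {d | (d, u i) ∈ B} := measurable_prodMk_right hB
  have measurableSet_hit : MeasurableSet {d | hit d} := by
    simp_rw [hit, Set.ofPred_exists]
    exact .iUnion measurableSet_hit_at
  have first_exists (d : D) : ∃ i, (d, u i) ∈ B ∨ ¬hit d := by
    by_cases hd : hit d
    · exact hd.imp fun i => Or.inl
    · exact ⟨0, Or.inr hd⟩
  let first (d : D) : ℕ := Nat.find (first_exists d)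
  have first_mem {d : D} (hd : hit d) : (d, u (first d)) ∈ B :=
    (Nat.find_spec (first_exists d)).resolve_right (not_not_intro hd)
  have measurable_first : Measurable fun d => u (first d) :=
    Measurable.find (f := fun i _ => u i) (p := fun i d => (d, u i) ∈ B ∨ ¬hit d)
      (fun _ => measurable_const) (fun i => (measurableSet_hit_at i).union measurableSet_hit.compl)
      first_exists
  refine ⟨fun d => if hit d then u (first d) else t₀,
    .ite measurableSet_hit measurable_first measurable_const, fun d => ?_, ?_⟩
  · by_cases hd : hit d
    · simpa only [if_pos hd] using Or.inr (first_mem hd)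
    · simp only [if_neg hd, true_or]
  · filter_upwards [hu] with d hd hpos
    rw [if_pos (hd hpos)]
    exact first_mem (hd hpos)

end Selection

theorem lintegral_eq_sum_fibers {X ι : Type*} [MeasurableSpace X] [Fintype ι] [MeasurableSpace ι]
    [MeasurableSingletonClass ι] {ζ : X → ι} (hζ : Measurable ζ) (q : Measure X) (f : X → ℝ≥0∞) :
    ∫⁻ x, f x ∂q = ∑ k, ∫⁻ x in ζ ⁻¹' {k}, f x ∂q := by
  have iUnion_fibers : ⋃ k, ζ ⁻¹' {k} = Set.univ := by ext x; simp
  rw [← setLIntegral_univ f, ← iUnion_fibers,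
    lintegral_iUnion (fun k => hζ (measurableSet_singleton k)) fun i j hij =>
      Disjoint.preimage ζ (Set.disjoint_singleton.2 hij), tsum_fintype]

theorem ae_measure_fiber_ne_zero {X ι : Type*} [MeasurableSpace X] [Countable ι] (ζ : X → ι)
    (q : Measure X) : ∀ᵐ x ∂q, q (ζ ⁻¹' {ζ x}) ≠ 0 := by
  have avoid_null : ∀ᵐ x ∂q, ∀ k, q (ζ ⁻¹' {k}) = 0 → ζ x ≠ k := ae_all_iff.2 fun k =>
    Filter.eventually_imp_distrib_left.2 measure_eq_zero_iff_ae_notMem.1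
  exact avoid_null.mono fun x hx h => hx _ h rfl

namespace BayesianRL

variable {S A : Type*} [MeasurableSpace S] [MeasurableSpace A] {H : ℕ} (M : BayesianRL S A H)

/-- The mean value in the environment `E` of the optimal policy of an environment sampled from
`q`. -/
noncomputable def samplingValue (q : Measure M.Θ) (E : Env A M.μS H) : ℝ≥0∞ :=
  ∫⁻ θ', lreturn E (M.opt θ') M.s₁ ∂q

variable {M}

section Families

variable {X : Type*} [MeasurableSpace X] {E : X → Env A M.μS H}

theorem measurable_lreturn_opt (hE : MeasurableEnvFamily E) :
    Measurable fun z : X × M.Θ => lreturn (E z.1) (M.opt z.2) M.s₁ :=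
  (measurable_lreturn (hE.comp measurable_fst)
    (M.measurablePolicyFamily_opt.comp measurable_snd)).comp
    (f := fun z : X × M.Θ => (z, M.s₁)) (by fun_prop)

theorem measurable_samplingValue (hE : MeasurableEnvFamily E) (κ : Kernel X M.Θ)
    [IsSFiniteKernel κ] : Measurable fun x => M.samplingValue (κ x) (E x) :=
  (measurable_lreturn_opt hE).lintegral_kernel_prod_right'

end Families

variable {q : Measure M.Θ} [IsProbabilityMeasure q]

theorem integrable_toReal_lreturn {Y : Type*} [MeasurableSpace Y] {μ : Measure Y}
    [IsFiniteMeasure μ] {E : Y → Env A M.μS H} {π : Y → Policy S M.μA H}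
    (hEπ : Measurable fun y => lreturn (E y) (π y) M.s₁) :
    Integrable (fun y => (lreturn (E y) (π y) M.s₁).toReal) μ := by
  refine integrable_toReal_of_lintegral_ne_top hEπ.aemeasurable
    (ne_top_of_le_ne_top ?_ (lintegral_mono fun y => lreturn_le _ _ _))
  rw [lintegral_const]
  exact ENNReal.mul_ne_top (ENNReal.natCast_ne_top H) (measure_ne_top μ _)

theorem lintegral_samplingValue_ne_top (E : M.Θ → Env A M.μS H) :
    ∫⁻ θ, M.samplingValue q (E θ) ∂q ≠ ∞ := by
  refine ne_top_of_le_ne_top (ENNReal.natCast_ne_top H) ?_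
  calc ∫⁻ θ, M.samplingValue q (E θ) ∂q
      ≤ ∫⁻ _, ∫⁻ _, (H : ℝ≥0∞) ∂q ∂q :=
        lintegral_mono fun θ => lintegral_mono fun θ' => lreturn_le _ _ _
    _ = H := by simp

theorem integral_V_sub_V {E : M.Θ → Env A M.μS H} (hE : MeasurableEnvFamily E) :
    ∫ z : M.Θ × M.Θ, (M.V (E z.1) (M.opt z.1) - M.V (E z.1) (M.opt z.2)) ∂(q.prod q) =
      ∫ θ, M.V (E θ) (M.opt θ) ∂q - (∫⁻ θ, M.samplingValue q (E θ) ∂q).toReal := by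
  have measurable_sampled := measurable_lreturn_opt hE
  have measurable_optimal : Measurable fun θ => lreturn (E θ) (M.opt θ) M.s₁ :=
    measurable_sampled.comp (f := fun θ => (θ, θ)) (by fun_prop)
  have integral_optimal :
      ∫ z : M.Θ × M.Θ, (lreturn (E z.1) (M.opt z.1) M.s₁).toReal ∂(q.prod q) =
        ∫ θ, (lreturn (E θ) (M.opt θ) M.s₁).toReal ∂q := by
    simpa using integral_fun_fst (μ := q) (ν := q)
      fun θ => (lreturn (E θ) (M.opt θ) M.s₁).toReal
  have integral_sampled :
      ∫ z : M.Θ × M.Θ, (lreturn (E z.1) (M.opt z.2) M.s₁).toReal ∂(q.prod q) =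
        (∫⁻ θ, M.samplingValue q (E θ) ∂q).toReal := by
    rw [integral_toReal measurable_sampled.aemeasurable (ae_of_all _ fun z =>
      (lreturn_le _ _ _).trans_lt (ENNReal.natCast_lt_top H)),
      lintegral_prod _ measurable_sampled.aemeasurable]
    rfl
  simp_rw [V_eq]
  rw [integral_sub (integrable_toReal_lreturn (measurable_optimal.comp measurable_fst))
    (integrable_toReal_lreturn measurable_sampled), integral_optimal, integral_sampled]

theorem measurableEnvFamily_of_fin {K : ℕ} (E : Fin K → Env A M.μS H) : MeasurableEnvFamily E :=
  fun h => ⟨measurable_from_prod_countable_right fun k => (E k h).1.measurable_dens,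
    measurable_from_prod_countable_right fun k => (E k h).2.measurable_dens⟩

theorem tsRegret_sub_surrogateRegret_le {K : ℕ} {ζ : M.Θ → Fin K} (hζ : Measurable ζ)
    (E : Fin K → Env A M.μS H) {ε : ℝ}
    (hopt : ∀ᵐ θ ∂q, M.V (M.env θ) (M.opt θ) - M.V (E (ζ θ)) (M.opt θ) ≤ ε)
    (hsampled : ∀ k, M.samplingValue q (E k) * q (ζ ⁻¹' {k}) ≤
      ∫⁻ θ in ζ ⁻¹' {k}, M.samplingValue q (M.env θ) ∂q) :
    M.tsRegret q - M.surrogateRegret q ζ E ≤ ε := by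
  have measurable_surrogate : MeasurableEnvFamily fun θ => E (ζ θ) :=
    (measurableEnvFamily_of_fin E).comp hζ
  have integrable_V {F : M.Θ → Env A M.μS H} (hF : MeasurableEnvFamily F) :
      Integrable (fun θ => M.V (F θ) (M.opt θ)) q := by
    simp_rw [V_eq]
    exact integrable_toReal_lreturn
      ((measurable_lreturn_opt hF).comp (f := fun θ => (θ, θ)) (by fun_prop))
  have optimal_le : ∫ θ, M.V (M.env θ) (M.opt θ) ∂q - ∫ θ, M.V (E (ζ θ)) (M.opt θ) ∂q ≤ ε := by
    rw [← integral_sub (integrable_V M.measurableEnvFamily_env) (integrable_V measurable_surrogate)]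
    simpa using integral_mono_ae ((integrable_V M.measurableEnvFamily_env).sub
      (integrable_V measurable_surrogate)) (integrable_const ε) hopt
  have sampled_le : ∫⁻ θ, M.samplingValue q (E (ζ θ)) ∂q ≤
      ∫⁻ θ, M.samplingValue q (M.env θ) ∂q := by
    rw [lintegral_eq_sum_fibers hζ, lintegral_eq_sum_fibers hζ]
    refine Finset.sum_le_sum fun k _ => le_trans (le_of_eq ?_) (hsampled k)
    rw [← setLIntegral_const]
    exact setLIntegral_congr_fun (hζ (measurableSet_singleton k)) fun θ hθ =>
      congrArg (fun k => M.samplingValue q (E k)) hθ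
  rw [tsRegret, surrogateRegret, integral_V_sub_V M.measurableEnvFamily_env,
    integral_V_sub_V measurable_surrogate]
  linarith [ENNReal.toReal_mono (lintegral_samplingValue_ne_top M.env) sampled_le]

end BayesianRL

section CondKernel

variable {X Y : Type*} [MeasurableSpace X] [MeasurableSpace Y]

open Classical in
/-- The kernel `κ` conditioned on `s`. At the points where `s` is a null set, which cannot be
conditioned on, it takes the value `dirac y₀`, so that it is a Markov kernel. -/
noncomputable def condKernelOrDirac (κ : Kernel X Y) {s : Set Y}
    (hs : MeasurableSet s) (y₀ : Y) : Kernel X Y where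
  toFun x := if κ x s = 0 then Measure.dirac y₀ else (κ x)[|s]
  measurable' := by
    refine .ite (κ.measurable_coe hs (measurableSet_singleton 0)) measurable_const ?_
    refine Measure.measurable_of_measurable_coe _ fun t ht => ?_
    simp_rw [cond_apply hs]
    exact (κ.measurable_coe hs).inv.mul (κ.measurable_coe (hs.inter ht))

variable {κ : Kernel X Y} {s : Set Y} (hs : MeasurableSet s) (y₀ : Y)

theorem condKernelOrDirac_apply {x : X} (hx : κ x s ≠ 0) :
    condKernelOrDirac κ hs y₀ x = (κ x)[|s] :=
  if_neg hx

instance [IsFiniteKernel κ] : IsMarkovKernel (condKernelOrDirac κ hs y₀) where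
  isProbabilityMeasure x := by
    by_cases hx : κ x s = 0
    · rw [show condKernelOrDirac κ hs y₀ x = Measure.dirac y₀ from if_pos hx]
      infer_instance
    · rw [condKernelOrDirac_apply hs y₀ hx]
      exact cond_isProbabilityMeasure hx

end CondKernel

namespace BayesianRL

variable {S A : Type*} [MeasurableSpace S] [MeasurableSpace A] {H : ℕ} {M : BayesianRL S A H}

section Candidates

variable {X : Type*} [MeasurableSpace X]

/-- The pairs `(x, θ)` such that `θ` lies in `s` and its sampling value under `κ x` is at most the
mean sampling value over `s`. The mean is multiplied out, so that a null set `s` does no harm. -/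
def surrogateCandidates (κ : Kernel X M.Θ) (s : Set M.Θ) : Set (X × M.Θ) :=
  {z | z.2 ∈ s ∧ M.samplingValue (κ z.1) (M.env z.2) * κ z.1 s ≤
    ∫⁻ θ in s, M.samplingValue (κ z.1) (M.env θ) ∂(κ z.1)}

variable (κ : Kernel X M.Θ) {s : Set M.Θ}

theorem measurable_samplingValue_env [IsSFiniteKernel κ] :
    Measurable fun z : X × M.Θ => M.samplingValue (κ z.1) (M.env z.2) :=
  measurable_samplingValue (M.measurableEnvFamily_env.comp measurable_snd)
    (κ.comap (Prod.fst : X × M.Θ → X) measurable_fst)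

theorem measurableSet_surrogateCandidates [IsSFiniteKernel κ] (hs : MeasurableSet s) :
    MeasurableSet (surrogateCandidates κ s) := by
  refine (measurable_snd hs).inter (measurableSet_le ((measurable_samplingValue_env κ).mul
    ((κ.measurable_coe hs).comp measurable_fst)) ?_)
  simp_rw [← lintegral_indicator hs]
  exact (Measurable.lintegral_kernel_prod_right'
    (f := fun z : X × M.Θ => s.indicator (fun θ => M.samplingValue (κ z.1) (M.env θ)) z.2)
    ((measurable_samplingValue_env κ).indicator (measurable_snd hs))).comp measurable_fst

theorem measure_surrogateCandidates_ne_zero [IsFiniteKernel κ] {x : X} (hx : κ x s ≠ 0) :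
    κ x (Prod.mk x ⁻¹' surrogateCandidates κ s) ≠ 0 := by
  have le_average_pos := measure_le_setLAverage_pos hx (measure_ne_top _ s)
    ((measurable_samplingValue_env κ).comp (measurable_prodMk_left (x := x))).aemeasurable
  rw [setLAverage_eq] at le_average_pos
  refine (le_average_pos.trans_le (measure_mono fun θ hθ => ?_)).ne'
  exact ⟨hθ.1, ENNReal.mul_le_of_le_div hθ.2⟩

end Candidates

variable {Q : ∀ n, Kernel (M.Hist n) M.Θ} {ε : ℝ} {K : ℕ} {ζ : M.Θ → Fin K}

theorem IsValuePartition.measurableSet_cell (hζ : M.IsValuePartition ε ζ) (k : Fin K) :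
    MeasurableSet (ζ ⁻¹' {k}) :=
  hζ.1 (measurableSet_singleton k)

theorem IsPosterior.ae_absolutelyContinuous (hQ : M.IsPosterior Q) (n : ℕ) :
    ∀ᵐ d ∂(M.histLaw Q n), Q n d ≪ M.prior := by
  filter_upwards [hQ.ae_eq_smul_withDensity n] with d ⟨C, hC⟩
  rw [hC]
  exact (withDensity_absolutelyContinuous _ _).smul_left C

theorem IsPosterior.exists_mem_surrogateCandidates (hQ : M.IsPosterior Q) (n : ℕ) {s : Set M.Θ}
    (hs : MeasurableSet s) :
    ∃ f : M.Hist n → M.Θ, Measurable f ∧ (s.Nonempty → ∀ d, f d ∈ s) ∧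
      ∀ᵐ d ∂(M.histLaw Q n), Q n d s ≠ 0 → (d, f d) ∈ surrogateCandidates (Q n) s := by
  have := (hQ n).1
  have := hQ.isProbabilityMeasure_histLaw n
  have ⟨t₀, ht₀⟩ : ∃ t₀ : M.Θ, s.Nonempty → t₀ ∈ s := by
    by_cases h : s.Nonempty
    · exact h.imp fun t ht _ => ht
    · exact M.prior.nonempty_of_neZero.elim fun t => ⟨t, fun hs => absurd hs h⟩
  obtain ⟨f, measurable_f, f_eq_or_mem, f_mem⟩ := exists_measurable_selection (M.histLaw Q n)
    M.prior (measurableSet_surrogateCandidates (Q n) hs) t₀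
  refine ⟨f, measurable_f, fun h d => ?_, ?_⟩
  · rcases f_eq_or_mem d with hd | hd
    · exact hd ▸ ht₀ h
    · exact hd.1
  · filter_upwards [f_mem, hQ.ae_absolutelyContinuous n] with d hd hac hds
    exact hd fun h => measure_surrogateCandidates_ne_zero (Q n) hds (hac h)

theorem IsValuePartition.exists_env_surrogate (hζ : M.IsValuePartition ε ζ)
    (hQ : M.IsPosterior Q) (n : ℕ) :
    ∃ E : M.Hist n → Fin K → M.Θ,
      (∀ k, Measurable fun d => E d k) ∧
      (∀ d θ, ζ (E d (ζ θ)) = ζ θ) ∧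
      ∀ᵐ d ∂(M.histLaw Q n),
        M.tsRegret (Q n d) - M.surrogateRegret (Q n d) ζ (fun k => M.env (E d k)) ≤ ε := by
  have := (hQ n).1
  choose f measurable_f mem_cell mem_candidates using fun k =>
    hQ.exists_mem_surrogateCandidates n (hζ.measurableSet_cell k)
  have same_cell (d : M.Hist n) (θ : M.Θ) : ζ (f (ζ θ) d) = ζ θ := mem_cell (ζ θ) ⟨θ, rfl⟩ d
  refine ⟨fun d k => f k d, measurable_f, same_cell, ?_⟩
  filter_upwards [ae_all_iff.2 mem_candidates] with d hd
  refine tsRegret_sub_surrogateRegret_le hζ.1 _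
    (ae_of_all _ fun θ => hζ.2 θ _ (same_cell d θ).symm) fun k => ?_
  by_cases hk : Q n d (ζ ⁻¹' {k}) = 0
  · simp [hk]
  · exact (hd k hk).2

section MeanReturn

variable {q : Measure M.Θ} [IsProbabilityMeasure q] {E : Env A M.μS H}

theorem lintegral_lreturn_env_of_iIndepFun (hind : iIndepFun (fun (h : Fin H) (θ : M.Θ) => θ h) q)
    (π : Policy S M.μA H) : ∫⁻ θ, lreturn (M.env θ) π M.s₁ ∂q =
      lreturn (meanEnv M.measurableEnvFamily_env q) π M.s₁ :=
  lintegral_lreturn_of_iIndepFun M.measurableLayerFamily_layer measurable_pi_apply hind π M.s₁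

theorem IsValuePartition.V_sub_V_le_of_lreturn_eq (hζ : M.IsValuePartition ε ζ) {θ : M.Θ}
    (hcell : q (ζ ⁻¹' {ζ θ}) ≠ 0) (hE : lreturn E (M.opt θ) M.s₁ =
      ∫⁻ θ', lreturn (M.env θ') (M.opt θ) M.s₁ ∂(q[|ζ ⁻¹' {ζ θ}])) :
    M.V (M.env θ) (M.opt θ) - M.V E (M.opt θ) ≤ ε := by
  have := cond_isProbabilityMeasure hcell
  have measurable_return : Measurable fun θ' => lreturn (M.env θ') (M.opt θ) M.s₁ :=
    (measurable_lreturn_opt M.measurableEnvFamily_env).comp measurable_prodMk_right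
  have V_eq_integral :
      M.V E (M.opt θ) = ∫ θ', M.V (M.env θ') (M.opt θ) ∂(q[|ζ ⁻¹' {ζ θ}]) := by
    simp_rw [V_eq]
    rw [hE, integral_toReal measurable_return.aemeasurable (ae_of_all _ fun θ' =>
      (lreturn_le _ _ _).trans_lt (ENNReal.natCast_lt_top H))]
  have integrable_V : Integrable (fun θ' => M.V (M.env θ') (M.opt θ)) (q[|ζ ⁻¹' {ζ θ}]) := by
    simp_rw [V_eq]
    exact integrable_toReal_lreturn measurable_return
  have le_on_cell : ∀ᵐ θ' ∂(q[|ζ ⁻¹' {ζ θ}]),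
      M.V (M.env θ) (M.opt θ) - ε ≤ M.V (M.env θ') (M.opt θ) := by
    filter_upwards [ae_cond_mem (hζ.measurableSet_cell (ζ θ))] with θ' hθ'
    linarith [hζ.2 θ θ' hθ'.symm]
  have le_mean := integral_mono_ae (integrable_const _) integrable_V le_on_cell
  simp only [integral_const, probReal_univ, one_smul] at le_mean
  linarith

theorem samplingValue_mul_of_lreturn_eq {s : Set M.Θ} (hs : q s ≠ 0)
    (hE : ∀ π : Policy S M.μA H, lreturn E π M.s₁ = ∫⁻ θ, lreturn (M.env θ) π M.s₁ ∂(q[|s])) :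
    M.samplingValue q E * q s = ∫⁻ θ in s, M.samplingValue q (M.env θ) ∂q := by
  have swap : M.samplingValue q E = ∫⁻ θ, M.samplingValue q (M.env θ) ∂(q[|s]) := by
    have := cond_isProbabilityMeasure hs
    simp_rw [samplingValue, hE]
    exact lintegral_lintegral_swap (f := fun θ' θ => lreturn (M.env θ) (M.opt θ') M.s₁)
      ((measurable_lreturn_opt M.measurableEnvFamily_env).comp measurable_swap).aemeasurable
  rw [swap, ProbabilityTheory.cond, lintegral_smul_measure, smul_eq_mul, mul_right_comm,
    ENNReal.inv_mul_cancel hs (measure_ne_top q s), one_mul]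

end MeanReturn

theorem IsValuePartition.exists_meanEnv_surrogate (hζ : M.IsValuePartition ε ζ)
    (hlayered : M.IsLayered ζ) (hQ : M.IsPosterior Q) (n : ℕ) :
    ∃ E : M.Hist n → Fin K → Env A M.μS H,
      (∀ k, M.MeasurableEnv fun d => E d k) ∧
      (∀ d k, Q n d (ζ ⁻¹' {k}) ≠ 0 → M.IsMeanEnv ((Q n d)[|ζ ⁻¹' {k}]) (E d k)) ∧
      ∀ᵐ d ∂(M.histLaw Q n),
        M.tsRegret (Q n d) - M.surrogateRegret (Q n d) ζ (E d) ≤ ε := by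
  have := (hQ n).1
  have ⟨θ₀⟩ : Nonempty M.Θ := M.prior.nonempty_of_neZero
  let κ (k : Fin K) : Kernel (M.Hist n) M.Θ :=
    condKernelOrDirac (Q n) (hζ.measurableSet_cell k) θ₀
  have κ_eq_cond {d : M.Hist n} {k : Fin K} (hk : Q n d (ζ ⁻¹' {k}) ≠ 0) :
      κ k d = (Q n d)[|ζ ⁻¹' {k}] := condKernelOrDirac_apply _ _ hk
  refine ⟨fun d k => meanEnv M.measurableEnvFamily_env (κ k d),
    fun k h => (M.measurableEnvFamily_env h).meanLayer (κ k), fun d k hk => ?_, ?_⟩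
  · rw [← κ_eq_cond hk]
    exact fun h s a => ⟨fun s' => rfl, fun x => rfl⟩
  filter_upwards [hQ.ae_eq_smul_withDensity n] with d ⟨C, hC⟩
  have mean_return {k : Fin K} (hk : Q n d (ζ ⁻¹' {k}) ≠ 0) (π : Policy S M.μA H) :
      lreturn (meanEnv M.measurableEnvFamily_env (κ k d)) π M.s₁ =
        ∫⁻ θ, lreturn (M.env θ) π M.s₁ ∂((Q n d)[|ζ ⁻¹' {k}]) := by
    rw [← κ_eq_cond hk]
    exact (lintegral_lreturn_env_of_iIndepFun
      (κ_eq_cond hk ▸ hlayered.iIndepFun_cond hζ.1 hC hk) π).symm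
  refine tsRegret_sub_surrogateRegret_le hζ.1 _ ?_ fun k => ?_
  · filter_upwards [ae_measure_fiber_ne_zero ζ (Q n d)] with θ hθ
    exact hζ.V_sub_V_le_of_lreturn_eq hθ (mean_return hθ _)
  · by_cases hk : Q n d (ζ ⁻¹' {k}) = 0
    · simp [hk]
    · exact (samplingValue_mul_of_lreturn_eq hk (mean_return hk)).le

end BayesianRL

theorem lemma2 {S A : Type*} [MeasurableSpace S] [MeasurableSpace A] {H : ℕ}
    (M : BayesianRL S A H)
    (Q : ∀ n, Kernel (M.Hist n) M.Θ) (hQ : M.IsPosterior Q)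
    (ε : ℝ) (hε : 0 < ε) {K : ℕ} (ζ : M.Θ → Fin K) (hζ : M.IsValuePartition ε ζ) (n : ℕ) :
    -- surrogate environments in `Θ`, for every partition
    (∃ E : M.Hist n → Fin K → M.Θ,
      (∀ k, Measurable fun d => E d k) ∧
      (∀ d θ, ζ (E d (ζ θ)) = ζ θ) ∧
      ∀ᵐ d ∂(M.histLaw Q n),
        M.tsRegret (Q n d) - M.surrogateRegret (Q n d) ζ (fun k => M.env (E d k)) ≤ ε) ∧
    -- the posterior means over the cells, for every layered partition
    (M.IsLayered ζ →
      ∃ E : M.Hist n → Fin K → Env A M.μS H,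
        (∀ k, M.MeasurableEnv fun d => E d k) ∧
        (∀ d k, Q n d (ζ ⁻¹' {k}) ≠ 0 → M.IsMeanEnv ((Q n d)[|ζ ⁻¹' {k}]) (E d k)) ∧
        ∀ᵐ d ∂(M.histLaw Q n),
          M.tsRegret (Q n d) - M.surrogateRegret (Q n d) ζ (E d) ≤ ε) := by
  exact ⟨hζ.exists_env_surrogate hQ n, fun hlayered => hζ.exists_meanEnv_surrogate hlayered hQ n⟩
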